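/- Let the three-dimensional Heisenberg group be $\mathbb R^3$ with the contact distribution $\mathcal D=\mathrm{span}\{F_1,F_2\}$, $F_1=\partial_x+\frac y2\partial_z$, $F_2=\partial_y-\frac x2\partial_z$, and with the sub-Riemannian metric $\mathbf g$ on $\mathcal D$ for which $(F_1,F_2)$ is orthonormal. For a surface $S\subset\mathbb R^3$, a Lipschitz curve $\gamma:[0,T]\to S$ is called admissible if $\dot\gamma(t)\in\mathcal D_{\gamma(t)}$ for almost every $t\in[0,T]$; its length is $L(\gamma)=\int_0^T\sqrt{\mathbf g(\dot\gamma(t),\dot\gamma(t))}\,dt$. The induced distance on $S$ is $$d_S(q_0,q_1)=\inf\{L(\gamma):\gamma \text{ admissible},\ \gamma(0)=q_0,\ \gamma(T)=q_1\}\in[0,\infty],\qquad q_0,q_1\in S,$$ with $d_S(q_0,q_1)=\infty$ if there is no admissible curve from $q_0$ to $q_1$. The induced distance is called finite if $d_S(q_0,q_1)<\infty$ for all $q_0,q_1\in S$, and infinite otherwise. Then for every integer $g\ge 1$ there exists a closed (compact, connected, orientable) surface $S$ of genus $g$, smoothly embedded in the Heisenberg group, whose induced distance is infinite. -/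

import Mathlib

open Set MeasureTheory
open scoped ENNReal NNReal ContDiff

noncomputable section

namespace HeisenbergSurface

/-! ### The three-dimensional Heisenberg group -/

/-- The underlying manifold of the three-dimensional Heisenberg group, with coordinates
`(x, y, z) = (p 0, p 1, p 2)`. -/
abbrev Heis : Type := EuclideanSpace ℝ (Fin 3)

/-- The group law of the Heisenberg group,
`(x, y, z) * (x', y', z') = (x + x', y + y', z + z' + (y x' - x y') / 2)`. -/
def mul (p q : Heis) : Heis :=
  !₂[p 0 + q 0, p 1 + q 1, p 2 + q 2 + (p 1 * q 0 - p 0 * q 1) / 2]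

/-- The vector field `F₁ = ∂x + (y/2) ∂z`. -/
def F₁ (p : Heis) : Heis := !₂[1, 0, p 1 / 2]

/-- The vector field `F₂ = ∂y - (x/2) ∂z`. -/
def F₂ (p : Heis) : Heis := !₂[0, 1, -(p 0 / 2)]

/-- `F₁` is left-invariant: it is the velocity of right translation by `(t, 0, 0)`. -/
theorem mul_e₁ (p : Heis) (t : ℝ) : mul p !₂[t, 0, 0] = p + t • F₁ p := by
  ext i; fin_cases i <;> simp [mul, F₁]; ring

/-- `F₂` is left-invariant: it is the velocity of right translation by `(0, t, 0)`. -/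
theorem mul_e₂ (p : Heis) (t : ℝ) : mul p !₂[0, t, 0] = p + t • F₂ p := by
  ext i; fin_cases i <;> simp [mul, F₂]; ring

/-- The contact distribution `𝒟 = span {F₁, F₂}`. -/
def distribution (p : Heis) : Submodule ℝ Heis := Submodule.span ℝ {F₁ p, F₂ p}

/-- The sub-Riemannian metric on horizontal vectors, that is, the one for which `(F₁, F₂)` is
orthonormal: the coefficients of a horizontal vector `v` in this frame are `v 0` and `v 1`. -/
def metric (v w : Heis) : ℝ := v 0 * w 0 + v 1 * w 1

theorem metric_frame (p : Heis) (a b c d : ℝ) :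
    metric (a • F₁ p + b • F₂ p) (c • F₁ p + d • F₂ p) = a * c + b * d := by
  simp [metric, F₁, F₂]

/-! ### Admissible curves and the induced distance -/

/-- `γ : [0, T] → S` is a Lipschitz curve with values in `S` which is horizontal at almost every
time (only the restriction of `γ` to `[0, T]` matters). -/
structure IsAdmissible (S : Set Heis) (T : ℝ) (γ : ℝ → Heis) : Prop where
  nonneg : 0 ≤ T
  lipschitz : ∃ K : ℝ≥0, LipschitzOnWith K γ (Icc 0 T)
  mapsTo : MapsTo γ (Icc 0 T) S
  horizontal : ∀ᵐ t ∂(volume.restrict (Icc 0 T)), deriv γ t ∈ distribution (γ t)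

/-- The length `∫₀ᵀ √(g(γ', γ')) dt`. -/
def length (T : ℝ) (γ : ℝ → Heis) : ℝ :=
  ∫ t in (0 : ℝ)..T, √(metric (deriv γ t) (deriv γ t))

/-- The induced distance: the infimum of the lengths of the admissible curves on `S` from `q₀` to
`q₁`, equal to `∞` if there is none. -/
def inducedDist (S : Set Heis) (q₀ q₁ : Heis) : ℝ≥0∞ :=
  sInf {l | ∃ (T : ℝ) (γ : ℝ → Heis), IsAdmissible S T γ ∧ γ 0 = q₀ ∧ γ T = q₁ ∧
    l = ENNReal.ofReal (length T γ)}

/-- The induced distance of `S` is finite if it is finite for every pair of points of `S`. -/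
def HasFiniteInducedDist (S : Set Heis) : Prop :=
  ∀ q₀ ∈ S, ∀ q₁ ∈ S, inducedDist S q₀ q₁ ≠ ⊤

/-! ### Closed surfaces of genus `g` -/

/-- The closed unit disc in the plane. -/
abbrev Disc : Type := Metric.closedBall (0 : EuclideanSpace ℝ (Fin 2)) 1

/-- The interior of the disc. -/
def discInterior : Set Disc := {x | ‖(x : EuclideanSpace ℝ (Fin 2))‖ < 1}

/-- The boundary circle of the disc. -/
def discBoundary : Set Disc := {x | ‖(x : EuclideanSpace ℝ (Fin 2))‖ = 1}

/-- `φ` is an embedded closed disc in the surface `X`. -/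
structure IsEmbeddedDisc {X : Type} [TopologicalSpace X] (φ : Disc → X) : Prop where
  isEmbedding : Topology.IsEmbedding φ
  isOpen_interior : IsOpen (φ '' discInterior)

/-- What is left of `X` after the interior of the disc `φ` is deleted. -/
abbrev Punctured {X : Type} (φ : Disc → X) : Type := ↥(φ '' discInterior)ᶜ

/-- The boundary circle of `Punctured φ`. -/
def rim {X : Type} (φ : Disc → X) : Set (Punctured φ) := {x | (x : X) ∈ φ '' discBoundary}

/-- `Z` is a connected sum of the surfaces `X` and `Y`: the interior of an embedded closed disc is
deleted from each of them, and `Z` is obtained from the two remaining pieces by gluing them along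
their boundary circles. -/
def IsConnectedSum (X Y Z : Type) [TopologicalSpace X] [TopologicalSpace Y]
    [TopologicalSpace Z] : Prop :=
  ∃ (φ : Disc → X) (ψ : Disc → Y) (a : Punctured φ → Z) (b : Punctured ψ → Z),
    IsEmbeddedDisc φ ∧ IsEmbeddedDisc ψ ∧
    Topology.IsClosedEmbedding a ∧ Topology.IsClosedEmbedding b ∧
    range a ∪ range b = univ ∧
    range a ∩ range b = a '' rim φ ∧ range a ∩ range b = b '' rim ψ

/-- `X` is (homeomorphic to) the closed orientable surface of genus `g`, the connected sum of a
sphere with `g` tori. -/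
def IsClosedSurfaceOfGenus : ℕ → (X : Type) → [TopologicalSpace X] → Prop
  | 0, X, _ => Nonempty (X ≃ₜ Metric.sphere (0 : EuclideanSpace ℝ (Fin 3)) 1)
  | g + 1, X, _ => ∃ (Y : Type) (_ : TopologicalSpace Y),
      IsClosedSurfaceOfGenus g Y ∧ IsConnectedSum Y (Circle × Circle) X

/-- `S` is a smooth embedded surface: near each of its points it is the regular zero set of a
smooth function. -/
def IsEmbeddedSurface (S : Set Heis) : Prop :=
  ∀ p ∈ S, ∃ (U : Set Heis) (f : Heis → ℝ), IsOpen U ∧ p ∈ U ∧ ContDiffOn ℝ ∞ f U ∧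
    fderiv ℝ f p ≠ 0 ∧ S ∩ U = {x ∈ U | f x = 0}

end HeisenbergSurface

end

namespace HeisenbergSurface

open Topology Filter
open Polynomial.Chebyshev (node T_real_cos T_real_cosh node_eq_one node_eq_neg_one)

/-! ### Connected sums -/

/-! Write `T` for the Chebyshev polynomial of degree `g`. The surface is `T(z/l)² = h(x + iy)`. For
`h = baseHeight`, which is at most `1/2` and is nonnegative exactly on an annulus, this is a stack
of `g` disjoint tori, one around each zero of `T`, because every critical value of `T` is `±1`. The
function `height` raises `h` above `1` on a small disc around a point `c`; over that disc
neighbouring tori open up and are joined by `g - 1` necks, which gives genus `g`. Smoothness only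
needs `0` and `1` to be regular values of `h`, since `T T' = 0` forces `T² = 0` or `T² = 1`
(`isEmbeddedSurface_chebSurface`).

The genus is counted by cutting at the critical heights of `T`. If the profile is replaced by a line
of slope `1` above such a height, the upper part becomes a disc; restoring one more monotone branch
of `T` glues in a torus minus a disc (`isConnectedSum_sheeted`, `isClosedSurfaceOfGenus_chebClamp`).

The distance is infinite because the torus with largest `z/l` carries a closed horizontal curve that
horizontal curves cannot leave. On that torus put `|x + iy|² = 2 + cos φ` and `z = l Y(φ)`, where
`Y` is `leafHeight`. In polar coordinates horizontality reads `dz = -(r²/2) dθ`, so `θ + l A(φ)` is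
locally constant along horizontal curves, with `A' = 2Y'/(2 + cos φ)` (`leafAngle`). One turn of `φ`
changes `θ` by `-l A(2π)`. Integration by parts shows `A(2π) < 0`, so `l = 2π / A(2π)` makes the
leaf close up (`leafAngle_two_pi_neg`, `periodic_leaf`).

An admissible curve starting on this compact leaf stays on it (`IsAdmissible.mem_leaf`). The point
`c` is chosen off the projection of the leaf and the modified disc is taken so small that the leaf
remains on the surface; a point over that disc is then unreachable from the leaf
(`exists_infinite_inducedDist`). -/

theorem Disc.norm_le (x : Disc) : ‖x.1‖ ≤ 1 := mem_closedBall_zero_iff.1 x.2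

theorem norm_sq_two (x : EuclideanSpace ℝ (Fin 2)) : ‖x‖ ^ 2 = x 0 ^ 2 + x 1 ^ 2 := by
  rw [EuclideanSpace.norm_sq_eq]
  simp [Fin.sum_univ_two]

theorem norm_sq_three (x : EuclideanSpace ℝ (Fin 3)) :
    ‖x‖ ^ 2 = x 0 ^ 2 + x 1 ^ 2 + x 2 ^ 2 := by
  rw [EuclideanSpace.norm_sq_eq]
  simp [Fin.sum_univ_three]

theorem sphere_sum_sq (p : Metric.sphere (0 : EuclideanSpace ℝ (Fin 3)) 1) :
    p.1 0 ^ 2 + p.1 1 ^ 2 + p.1 2 ^ 2 = 1 := by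
  rw [← norm_sq_three, mem_sphere_zero_iff_norm.1 p.2, one_pow]

theorem compl_discInterior : discInteriorᶜ = discBoundary := by
  ext x
  have h := x.norm_le
  simp only [discInterior, discBoundary, mem_compl_iff, mem_ofPred_eq, not_lt]
  exact ⟨fun h' => le_antisymm h h', fun h' => h'.ge⟩

theorem IsConnectedSum.congr {X Y Z Z' : Type} [TopologicalSpace X] [TopologicalSpace Y]
    [TopologicalSpace Z] [TopologicalSpace Z'] (e : Z ≃ₜ Z') (H : IsConnectedSum X Y Z) :
    IsConnectedSum X Y Z' := by
  obtain ⟨φ, ψ, a, b, hφ, hψ, ha, hb, hu, h1, h2⟩ := H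
  refine ⟨φ, ψ, e ∘ a, e ∘ b, hφ, hψ, e.isClosedEmbedding.comp ha, e.isClosedEmbedding.comp hb,
    ?_, ?_, ?_⟩
  · rw [range_comp, range_comp, ← image_union, hu, image_univ, e.range_coe]
  · rw [range_comp, range_comp, ← image_inter e.injective, h1, image_comp]
  · rw [range_comp, range_comp, ← image_inter e.injective, h2, image_comp]

theorem IsEmbeddedDisc.comp_homeomorph {X Y : Type} [TopologicalSpace X] [TopologicalSpace Y]
    {φ : Disc → X} (hφ : IsEmbeddedDisc φ) (e : X ≃ₜ Y) : IsEmbeddedDisc (e ∘ φ) where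
  isEmbedding := e.isEmbedding.comp hφ.isEmbedding
  isOpen_interior := by
    rw [image_comp]
    exact e.isOpenMap _ hφ.isOpen_interior

/-- The homeomorphism of the punctured surfaces induced by a homeomorphism. -/
def puncturedHomeomorph {X Y : Type} [TopologicalSpace X] [TopologicalSpace Y]
    (φ : Disc → X) (e : X ≃ₜ Y) : Punctured φ ≃ₜ Punctured (e ∘ φ) :=
  e.subtype fun x => by
    rw [image_comp, mem_compl_iff, mem_compl_iff, e.injective.mem_set_image]

theorem image_rim {X Y : Type} [TopologicalSpace X] [TopologicalSpace Y]
    (φ : Disc → X) (e : X ≃ₜ Y) :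
    (puncturedHomeomorph φ e).symm '' rim (e ∘ φ) = rim φ := by
  rw [Homeomorph.image_symm]
  ext x
  change e x.1 ∈ (e ∘ φ) '' discBoundary ↔ x.1 ∈ φ '' discBoundary
  rw [image_comp, e.injective.mem_set_image]

theorem IsConnectedSum.congr_second {X Y Y' Z : Type} [TopologicalSpace X] [TopologicalSpace Y]
    [TopologicalSpace Y'] [TopologicalSpace Z] (e : Y ≃ₜ Y') (H : IsConnectedSum X Y Z) :
    IsConnectedSum X Y' Z := by
  obtain ⟨φ, ψ, a, b, hφ, hψ, ha, hb, hu, h1, h2⟩ := H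
  have hr : range (b ∘ (puncturedHomeomorph ψ e).symm) = range b :=
    (puncturedHomeomorph ψ e).symm.surjective.range_comp b
  refine ⟨φ, e ∘ ψ, a, b ∘ (puncturedHomeomorph ψ e).symm, hφ, hψ.comp_homeomorph e, ha,
    hb.comp (Homeomorph.isClosedEmbedding _), ?_, ?_, ?_⟩
  · rw [hr, hu]
  · rw [hr, h1]
  · rw [hr, h2, image_comp, image_rim]

theorem IsClosedSurfaceOfGenus.congr {X Y : Type} [TopologicalSpace X] [TopologicalSpace Y]
    (e : X ≃ₜ Y) : ∀ {g : ℕ}, IsClosedSurfaceOfGenus g X → IsClosedSurfaceOfGenus g Y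
  | 0, H => H.elim fun f => ⟨e.symm.trans f⟩
  | _ + 1, ⟨W, hW, H, H'⟩ => ⟨W, hW, H, H'.congr e⟩

/-- The upper hemisphere, as an embedded disc of the unit sphere. -/
noncomputable def hemisphere (x : Disc) : Metric.sphere (0 : EuclideanSpace ℝ (Fin 3)) 1 :=
  ⟨!₂[x.1 0, x.1 1, √(1 - ‖x.1‖ ^ 2)], by
    have h := x.norm_le
    have h2 : 0 ≤ 1 - ‖x.1‖ ^ 2 := by nlinarith [norm_nonneg x.1]
    rw [mem_sphere_zero_iff_norm, ← sq_eq_sq₀ (norm_nonneg _) zero_le_one, norm_sq_three]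
    change x.1 0 ^ 2 + x.1 1 ^ 2 + √(1 - ‖x.1‖ ^ 2) ^ 2 = 1 ^ 2
    rw [Real.sq_sqrt h2, norm_sq_two]; ring⟩

/-- The projection of the unit sphere to the disc. -/
def sphereProj (p : Metric.sphere (0 : EuclideanSpace ℝ (Fin 3)) 1) : Disc :=
  ⟨!₂[p.1 0, p.1 1], by
    have h := sphere_sum_sq p
    rw [mem_closedBall_zero_iff, ← sq_le_sq₀ (norm_nonneg _) zero_le_one, norm_sq_two]
    change p.1 0 ^ 2 + p.1 1 ^ 2 ≤ 1 ^ 2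
    nlinarith [sq_nonneg (p.1 2)]⟩

theorem sphereProj_norm_sq (p : Metric.sphere (0 : EuclideanSpace ℝ (Fin 3)) 1) :
    ‖(sphereProj p).1‖ ^ 2 = 1 - p.1 2 ^ 2 := by
  rw [norm_sq_two]
  change p.1 0 ^ 2 + p.1 1 ^ 2 = _
  linarith [sphere_sum_sq p]

theorem continuous_hemisphere : Continuous hemisphere := by
  unfold hemisphere
  fun_prop

theorem continuous_sphereProj : Continuous sphereProj := by
  unfold sphereProj
  fun_prop

theorem sphereProj_hemisphere (x : Disc) : sphereProj (hemisphere x) = x := by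
  ext i; fin_cases i <;> rfl

theorem hemisphere_sphereProj {p : Metric.sphere (0 : EuclideanSpace ℝ (Fin 3)) 1}
    (hp : 0 ≤ p.1 2) : hemisphere (sphereProj p) = p := by
  ext i; fin_cases i
  · rfl
  · rfl
  · change √(1 - ‖(sphereProj p).1‖ ^ 2) = p.1 2
    rw [sphereProj_norm_sq, sub_sub_cancel, Real.sqrt_sq hp]

theorem image_hemisphere_interior : hemisphere '' discInterior = {p | 0 < p.1 2} := by
  ext p
  constructor
  · rintro ⟨x, hx, rfl⟩
    change 0 < √(1 - ‖x.1‖ ^ 2)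
    have hx : ‖x.1‖ < 1 := hx
    have : ‖x.1‖ ^ 2 < 1 := by nlinarith [norm_nonneg x.1]
    exact Real.sqrt_pos.2 (by linarith)
  · intro hp
    refine ⟨sphereProj p, ?_, hemisphere_sphereProj (le_of_lt hp)⟩
    change ‖(sphereProj p).1‖ < 1
    have hp : 0 < p.1 2 := hp
    have := sphereProj_norm_sq p
    nlinarith [norm_nonneg (sphereProj p).1, mul_pos hp hp]

theorem isEmbeddedDisc_hemisphere : IsEmbeddedDisc hemisphere where
  isEmbedding := (continuous_hemisphere.isClosedEmbedding
    (Function.LeftInverse.injective sphereProj_hemisphere)).isEmbedding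
  isOpen_interior := by
    rw [image_hemisphere_interior]
    exact isOpen_lt continuous_const (by fun_prop)

/-- A sphere is neutral for the connected sum. -/
theorem isConnectedSum_sphere {X : Type} [TopologicalSpace X] [T2Space X] {ψ : Disc → X}
    (hψ : IsEmbeddedDisc ψ) :
    IsConnectedSum (Metric.sphere (0 : EuclideanSpace ℝ (Fin 3)) 1) X X := by
  have hlow (p : Punctured hemisphere) : p.1.1 2 ≤ 0 := by
    by_contra! h
    exact p.2 ((Set.ext_iff.1 image_hemisphere_interior _).2 h)
  have hcl : IsClosed (hemisphere '' discInterior)ᶜ :=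
    isEmbeddedDisc_hemisphere.isOpen_interior.isClosed_compl
  have : CompactSpace (Punctured hemisphere) :=
    isCompact_iff_compactSpace.1 hcl.isCompact
  -- The complement of the open upper hemisphere projects bijectively to the disc, so composing with
  -- `ψ` puts back exactly the disc removed from `X`.
  have hinj : Function.Injective fun p : Punctured hemisphere => sphereProj p.1 := by
    intro p q hpq
    have h0 : p.1.1 0 = q.1.1 0 := congrArg (fun x : Disc => x.1 0) hpq
    have h1 : p.1.1 1 = q.1.1 1 := congrArg (fun x : Disc => x.1 1) hpq
    have h2 : p.1.1 2 = q.1.1 2 := by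
      have := sphere_sum_sq p.1
      have := sphere_sum_sq q.1
      have hsq : p.1.1 2 ^ 2 = q.1.1 2 ^ 2 := by rw [h0, h1] at *; linarith
      nlinarith [hlow p, hlow q, sq_nonneg (p.1.1 2 - q.1.1 2), sq_eq_sq_iff_eq_or_eq_neg.1 hsq]
    ext i; fin_cases i
    exacts [h0, h1, h2]
  have hsurj : Function.Surjective fun p : Punctured hemisphere => sphereProj p.1 := by
    intro x
    have hmem : !₂[x.1 0, x.1 1, -√(1 - ‖x.1‖ ^ 2)] ∈
        Metric.sphere (0 : EuclideanSpace ℝ (Fin 3)) 1 := by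
      have := sphere_sum_sq (hemisphere x)
      rw [mem_sphere_zero_iff_norm, ← sq_eq_sq₀ (norm_nonneg _) zero_le_one, norm_sq_three]
      change x.1 0 ^ 2 + x.1 1 ^ 2 + √(1 - ‖x.1‖ ^ 2) ^ 2 = 1 at this
      change x.1 0 ^ 2 + x.1 1 ^ 2 + (-√(1 - ‖x.1‖ ^ 2)) ^ 2 = 1 ^ 2
      rw [neg_sq, this, one_pow]
    refine ⟨⟨⟨_, hmem⟩, ?_⟩, ?_⟩
    · rw [image_hemisphere_interior]
      simp
    · ext i; fin_cases i <;> rfl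
  have hr : range (fun p : Punctured hemisphere => ψ (sphereProj p.1)) = range ψ :=
    hsurj.range_comp ψ
  have hrψ : range ψ = ψ '' discInterior ∪ ψ '' discBoundary := by
    rw [← image_union, ← compl_discInterior, union_compl_self, image_univ]
  have hdisj : Disjoint (ψ '' discInterior) (ψ '' discBoundary) := by
    rw [← compl_discInterior]
    exact disjoint_image_of_injective hψ.isEmbedding.injective disjoint_compl_right
  have hrb : range ψ ∩ (ψ '' discInterior)ᶜ = ψ '' discBoundary := by
    rw [hrψ, union_inter_distrib_right, inter_compl_self, empty_union, inter_eq_left]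
    exact hdisj.subset_compl_left
  refine ⟨hemisphere, ψ, fun p => ψ (sphereProj p.1), Subtype.val, isEmbeddedDisc_hemisphere, hψ,
    Continuous.isClosedEmbedding (hψ.isEmbedding.continuous.comp
      (continuous_sphereProj.comp continuous_subtype_val)) (hψ.isEmbedding.injective.comp hinj),
    hψ.isOpen_interior.isClosed_compl.isClosedEmbedding_subtypeVal, ?_, ?_, ?_⟩
  · rw [hr, Subtype.range_coe]
    refine eq_univ_of_univ_subset ?_
    rw [← union_compl_self (ψ '' discInterior)]
    exact union_subset_union_left _ (image_subset_range _ _)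
  · rw [hr, Subtype.range_coe, hrb]
    ext y
    constructor
    · rintro ⟨x, hx, rfl⟩
      obtain ⟨p, rfl⟩ := hsurj x
      refine ⟨p, ?_, rfl⟩
      refine ⟨sphereProj p.1, hx, ?_⟩
      have h1 : ‖(sphereProj p.1).1‖ = 1 := hx
      have := sphereProj_norm_sq p.1
      rw [h1] at this
      exact hemisphere_sphereProj (by nlinarith)
    · rintro ⟨p, ⟨x, hx, hxp⟩, rfl⟩
      refine ⟨x, hx, ?_⟩
      change ψ x = ψ (sphereProj p.1)
      rw [← hxp, sphereProj_hemisphere]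
  · rw [hr, Subtype.range_coe, hrb]
    ext y
    constructor
    · intro hy
      exact ⟨⟨y, hdisj.subset_compl_left hy⟩, hy, rfl⟩
    · rintro ⟨p, hp, rfl⟩
      exact hp


/-! ### Surfaces `σ(y)² = h(ξ)` -/

/-- The surface `σ(y)² = h(ξ)` in `ℂ × ℝ`. -/
def sheeted (h : ℂ → ℝ) (σ : ℝ → ℝ) : Set (ℂ × ℝ) := {q | σ q.2 ^ 2 = h q.1}

/-- `h` is continuous, and `h ≥ 1` describes the closed disc with centre `c` and radius `ε`. -/
structure IsPillar (h : ℂ → ℝ) (c : ℂ) (ε : ℝ) : Prop where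
  continuous : Continuous h
  pos : 0 < ε
  one_le_iff : ∀ ξ, 1 ≤ h ξ ↔ ‖ξ - c‖ ≤ ε
  one_lt_iff : ∀ ξ, 1 < h ξ ↔ ‖ξ - c‖ < ε

theorem isClosed_sheeted {h : ℂ → ℝ} {σ : ℝ → ℝ} (hh : Continuous h) (hσ : Continuous σ) :
    IsClosed (sheeted h σ) :=
  isClosed_eq ((hσ.comp continuous_snd).pow 2) (hh.comp continuous_fst)

/-- The affine chart of the closed disc with centre `c` and radius `ε`. -/
def discPoint (c : ℂ) (ε : ℝ) (x : Disc) : ℂ := c + ε * ⟨x.1 0, x.1 1⟩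

theorem continuous_discPoint (c : ℂ) (ε : ℝ) : Continuous (discPoint c ε) := by
  have : Continuous fun x : Disc => Complex.equivRealProdCLM.symm (x.1 0, x.1 1) :=
    Complex.equivRealProdCLM.symm.continuous.comp (by fun_prop)
  exact continuous_const.add (continuous_const.mul this)

theorem norm_discPoint_sub (c : ℂ) {ε : ℝ} (hε : 0 < ε) (x : Disc) :
    ‖discPoint c ε x - c‖ = ε * ‖x.1‖ := by
  have : ‖(⟨x.1 0, x.1 1⟩ : ℂ)‖ = ‖x.1‖ := by
    rw [← sq_eq_sq₀ (norm_nonneg _) (norm_nonneg _), norm_sq_two, Complex.sq_norm,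
      Complex.normSq_mk]
    ring
  rw [discPoint, add_sub_cancel_left, norm_mul, this, Complex.norm_real, Real.norm_eq_abs,
    abs_of_pos hε]

theorem injective_discPoint (c : ℂ) {ε : ℝ} (hε : 0 < ε) :
    Function.Injective (discPoint c ε) := by
  intro x y hxy
  have h := mul_left_cancel₀ (Complex.ofReal_ne_zero.2 hε.ne') (add_left_cancel hxy)
  ext i; fin_cases i
  · exact congrArg Complex.re h
  · exact congrArg Complex.im h

theorem exists_discPoint_eq {c : ℂ} {ε : ℝ} (hε : 0 < ε) {ξ : ℂ} (hξ : ‖ξ - c‖ ≤ ε) :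
    ∃ x, discPoint c ε x = ξ := by
  have hn : ‖!₂[((ξ - c) / ε).re, ((ξ - c) / ε).im]‖ = ‖(ξ - c) / ε‖ := by
    rw [← sq_eq_sq₀ (norm_nonneg _) (norm_nonneg _), norm_sq_two, Complex.sq_norm,
      Complex.normSq_apply]
    change ((ξ - c) / ε).re ^ 2 + ((ξ - c) / ε).im ^ 2 = _
    ring
  refine ⟨⟨_, mem_closedBall_zero_iff.2 (hn.trans_le ?_)⟩, ?_⟩
  · rw [norm_div, Complex.norm_real, Real.norm_eq_abs, abs_of_pos hε]
    exact (div_le_one hε).2 hξ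
  · change c + ε * ((ξ - c) / ε) = ξ
    rw [mul_div_cancel₀ _ (Complex.ofReal_ne_zero.2 hε.ne')]
    ring

/-- The disc is the graph of `u` over the disc `h ≥ 1`. The sets `O` and `B` describe its interior
and boundary by conditions on the height alone; openness of `O` is what makes the interior open in
the surface. -/
theorem exists_isEmbeddedDisc {h : ℂ → ℝ} {σ : ℝ → ℝ} {c : ℂ} {ε : ℝ} (hh : IsPillar h c ε)
    {u : ℂ → ℝ} (hu : Continuous u) {O B : Set (ℂ × ℝ)} (hO : IsOpen O)
    (hus : ∀ ξ, 1 ≤ h ξ → σ (u ξ) ^ 2 = h ξ)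
    (hO' : ∀ q ∈ sheeted h σ, q ∈ O ↔ 1 < h q.1 ∧ q.2 = u q.1)
    (hB : ∀ q ∈ sheeted h σ, q ∈ B ↔ h q.1 = 1 ∧ q.2 = u q.1) :
    ∃ φ : Disc → sheeted h σ, IsEmbeddedDisc φ ∧ φ '' discInterior = {q | q.1 ∈ O} ∧
      φ '' discBoundary = {q | q.1 ∈ B} := by
  have hle (x : Disc) : 1 ≤ h (discPoint c ε x) := by
    rw [hh.one_le_iff, norm_discPoint_sub c hh.pos]
    exact mul_le_of_le_one_right hh.pos.le x.norm_le
  have hlt (x : Disc) : 1 < h (discPoint c ε x) ↔ x ∈ discInterior := by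
    rw [hh.one_lt_iff, norm_discPoint_sub c hh.pos]
    exact mul_lt_iff_lt_one_right hh.pos
  have heq (x : Disc) : h (discPoint c ε x) = 1 ↔ x ∈ discBoundary := by
    rw [← compl_discInterior, mem_compl_iff, ← hlt, not_lt]
    exact ⟨fun h => h.le, fun h => le_antisymm h (hle x)⟩
  let φ (x : Disc) : sheeted h σ := ⟨(discPoint c ε x, u (discPoint c ε x)), hus _ (hle x)⟩
  have hφ : Continuous φ := Continuous.subtype_mk ((continuous_discPoint c ε).prodMk
    (hu.comp (continuous_discPoint c ε))) _
  have hinj : Function.Injective φ := fun x y hxy =>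
    injective_discPoint c hh.pos (congrArg (fun q : sheeted h σ => q.1.1) hxy)
  have himg (q : sheeted h σ) (h1 : 1 ≤ h q.1.1) (h2 : q.1.2 = u q.1.1) : ∃ x, φ x = q := by
    obtain ⟨x, hx⟩ := exists_discPoint_eq hh.pos ((hh.one_le_iff _).1 h1)
    refine ⟨x, Subtype.ext (Prod.ext hx ?_)⟩
    change u (discPoint c ε x) = _
    rw [hx, h2]
  have hint : φ '' discInterior = {q | q.1 ∈ O} := by
    ext q
    constructor
    · rintro ⟨x, hx, rfl⟩
      exact (hO' _ (φ x).2).2 ⟨(hlt x).2 hx, rfl⟩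
    · intro hq
      obtain ⟨h1, h2⟩ := (hO' _ q.2).1 hq
      obtain ⟨x, rfl⟩ := himg q h1.le h2
      exact ⟨x, (hlt x).1 h1, rfl⟩
  refine ⟨φ, ⟨(hφ.isClosedEmbedding hinj).isEmbedding, ?_⟩, hint, ?_⟩
  · rw [hint]
    exact hO.preimage continuous_subtype_val
  · ext q
    constructor
    · rintro ⟨x, hx, rfl⟩
      exact (hB _ (φ x).2).2 ⟨(heq x).2 hx, rfl⟩
    · intro hq
      obtain ⟨h1, h2⟩ := (hB _ q.2).1 hq
      obtain ⟨x, rfl⟩ := himg q h1.ge h2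
      exact ⟨x, (heq x).1 h1, rfl⟩

/-- The lower sheet of `ζ² = h(ξ)` over the disc `h ≥ 1`. -/
theorem exists_isEmbeddedDisc_id {h : ℂ → ℝ} {c : ℂ} {ε : ℝ} (hh : IsPillar h c ε) :
    ∃ φ : Disc → sheeted h id, IsEmbeddedDisc φ ∧ φ '' discInterior = {q | q.1.2 < -1} ∧
      φ '' discBoundary = {q | q.1.2 = -1} := by
  refine exists_isEmbeddedDisc hh (u := fun ξ => -√(h ξ)) (O := {q | q.2 < -1})
    (B := {q | q.2 = -1}) (by have := hh.continuous; fun_prop)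
    (isOpen_lt continuous_snd continuous_const) ?_ ?_ ?_
  · intro ξ hξ
    simp [Real.sq_sqrt (zero_le_one.trans hξ)]
  · rintro ⟨ξ, ζ⟩ (hq : ζ ^ 2 = h ξ)
    change ζ < -1 ↔ 1 < h ξ ∧ ζ = -√(h ξ)
    rw [← hq, Real.sqrt_sq_eq_abs]
    constructor
    · intro h1
      exact ⟨by nlinarith, by rw [abs_of_neg (by linarith), neg_neg]⟩
    · rintro ⟨h1, h2⟩
      have h3 : 1 < |ζ| := by rwa [one_lt_sq_iff_one_lt_abs] at h1
      linarith
  · rintro ⟨ξ, ζ⟩ (hq : ζ ^ 2 = h ξ)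
    change ζ = -1 ↔ h ξ = 1 ∧ ζ = -√(h ξ)
    constructor
    · rintro rfl
      rw [← hq]; norm_num
    · rintro ⟨h1, h2⟩
      rw [h2, h1, Real.sqrt_one]

/-- Changing the profile `σ` above a height where `σ² = 1` adds a handle to the surface
`σ(y)² = h(ξ)`. -/
theorem isConnectedSum_sheeted {h : ℂ → ℝ} {c : ℂ} {ε : ℝ} (hh : IsPillar h c ε)
    [CompactSpace (sheeted h id)] {σ σ' : ℝ → ℝ} (hσ : Continuous σ) (hσ' : Continuous σ')
    {d : ℝ} (hd : ∀ y ≤ d, σ' y ^ 2 = σ y ^ 2) (hcap : ∀ y, d ≤ y → σ y = 1 + (y - d))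
    (e : ℝ ≃o ℝ) (he : e d = -1) (hσe : ∀ y, d ≤ y → σ' y = e y) :
    IsConnectedSum (sheeted h σ) (sheeted h id) (sheeted h σ') := by
  have hed : e.symm (-1) = d := by rw [← he, e.symm_apply_apply]
  obtain ⟨φ, hφ, hφi, hφb⟩ : ∃ φ : Disc → sheeted h σ, IsEmbeddedDisc φ ∧
      φ '' discInterior = {q | q.1 ∈ {q : ℂ × ℝ | d < q.2}} ∧
      φ '' discBoundary = {q | q.1 ∈ {q : ℂ × ℝ | q.2 = d}} := by
    -- Above `d` the profile is `σ(y) = 1 + (y - d)`, and the equation `σ(y)² = h(ξ)` solves to this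
    -- `u`: the old surface ends in a cap.
    refine exists_isEmbeddedDisc hh (u := fun ξ => d + √(h ξ) - 1)
      (by have := hh.continuous; fun_prop) (isOpen_lt continuous_const continuous_snd) ?_ ?_ ?_
    · intro ξ hξ
      have := Real.one_le_sqrt.2 hξ
      rw [hcap _ (by linarith)]
      ring_nf
      exact Real.sq_sqrt (zero_le_one.trans hξ)
    · rintro ⟨ξ, y⟩ (hq : σ y ^ 2 = h ξ)
      change d < y ↔ 1 < h ξ ∧ y = d + √(h ξ) - 1
      constructor
      · intro hy
        rw [← hq, hcap y hy.le, Real.sqrt_sq (by linarith)]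
        exact ⟨by nlinarith, by ring⟩
      · rintro ⟨h1, h2⟩
        have : 1 < √(h ξ) := by rwa [Real.lt_sqrt zero_le_one, one_pow]
        linarith
    · rintro ⟨ξ, y⟩ (hq : σ y ^ 2 = h ξ)
      change y = d ↔ h ξ = 1 ∧ y = d + √(h ξ) - 1
      constructor
      · rintro rfl
        rw [← hq, hcap y le_rfl]
        norm_num
      · rintro ⟨h1, h2⟩
        rw [h2, h1, Real.sqrt_one]; ring
  obtain ⟨ψ, hψ, hψi, hψb⟩ := exists_isEmbeddedDisc_id hh
  have hφp (x : Punctured φ) : x.1.1.2 ≤ d := by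
    by_contra! hx
    exact x.2 ((Set.ext_iff.1 hφi _).2 hx)
  have hψp (x : Punctured ψ) : -1 ≤ x.1.1.2 := by
    by_contra! hx
    exact x.2 ((Set.ext_iff.1 hψi _).2 hx)
  have hsymm (ζ : ℝ) (hζ : -1 ≤ ζ) : d ≤ e.symm ζ := by
    rw [← hed]; exact e.symm.monotone hζ
  have hcφ : IsClosed (φ '' discInterior)ᶜ := hφ.isOpen_interior.isClosed_compl
  have : CompactSpace (Punctured ψ) :=
    isCompact_iff_compactSpace.1 hψ.isOpen_interior.isClosed_compl.isCompact
  -- Below `d` the old and new surfaces coincide; above `d` the new one is the torus `ζ² = h(ξ)`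
  -- without its part `ζ < -1`, transported by `ζ ↦ e⁻¹(ζ)`. They meet at height `d`, which
  -- corresponds to `ζ = -1`.
  let a (x : Punctured φ) : sheeted h σ' := ⟨x.1.1, (hd _ (hφp x)).trans x.1.2⟩
  let b (x : Punctured ψ) : sheeted h σ' := ⟨(x.1.1.1, e.symm x.1.1.2), by
    change σ' (e.symm x.1.1.2) ^ 2 = h x.1.1.1
    rw [hσe _ (hsymm _ (hψp x)), e.apply_symm_apply]
    exact x.1.2⟩
  have ha : range a = {q | q.1.2 ≤ d} := by
    ext q
    constructor
    · rintro ⟨x, rfl⟩; exact hφp x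
    · intro hq
      refine ⟨⟨⟨q.1, (hd _ hq).symm.trans q.2⟩, fun hx => ?_⟩, rfl⟩
      have h1 : d < q.1.2 := (Set.ext_iff.1 hφi _).1 hx
      exact not_lt_of_ge hq h1
  have hb : range b = {q | d ≤ q.1.2} := by
    ext q
    constructor
    · rintro ⟨x, rfl⟩; exact hsymm _ (hψp x)
    · intro hq
      have hq : d ≤ q.1.2 := hq
      refine ⟨⟨⟨(q.1.1, e q.1.2), ?_⟩, fun hx => ?_⟩, ?_⟩
      · change e q.1.2 ^ 2 = h q.1.1
        rw [← hσe _ hq]; exact q.2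
      · have h1 : e q.1.2 < -1 := (Set.ext_iff.1 hψi _).1 hx
        rw [← he] at h1
        exact not_lt_of_ge (e.monotone hq) h1
      · exact Subtype.ext (Prod.ext rfl (e.symm_apply_apply _))
  have hab : range a ∩ range b = {q | q.1.2 = d} := by
    rw [ha, hb]; ext q
    exact ⟨fun hq => le_antisymm hq.1 hq.2, fun hq => ⟨le_of_eq hq, ge_of_eq hq⟩⟩
  refine ⟨φ, ψ, a, b, hφ, hψ, ?_, ?_, ?_, ?_, ?_⟩
  · have h1 : IsClosedEmbedding (Subtype.val : sheeted h σ' → ℂ × ℝ) :=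
      (isClosed_sheeted hh.continuous hσ').isClosedEmbedding_subtypeVal
    rw [← h1.of_comp_iff]
    exact (isClosed_sheeted hh.continuous hσ).isClosedEmbedding_subtypeVal.comp
      hcφ.isClosedEmbedding_subtypeVal
  · refine Continuous.isClosedEmbedding (Continuous.subtype_mk ?_ _) ?_
    · have := e.symm.continuous
      fun_prop
    · intro x y hxy
      have h1 : x.1.1.1 = y.1.1.1 := congrArg (fun q : sheeted h σ' => q.1.1) hxy
      have h2 : e.symm x.1.1.2 = e.symm y.1.1.2 := congrArg (fun q : sheeted h σ' => q.1.2) hxy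
      exact Subtype.ext (Subtype.ext (Prod.ext h1 (e.symm.injective h2)))
  · rw [ha, hb]
    exact eq_univ_of_forall fun q => le_total q.1.2 d
  · rw [hab]; ext q
    constructor
    · intro hq
      obtain ⟨x, rfl⟩ : q ∈ range a := by rw [ha]; exact le_of_eq hq
      exact ⟨x, (Set.ext_iff.1 hφb _).2 hq, rfl⟩
    · rintro ⟨x, hx, rfl⟩
      exact (Set.ext_iff.1 hφb _).1 hx
  · rw [hab]; ext q
    constructor
    · intro hq
      obtain ⟨x, rfl⟩ : q ∈ range b := by rw [hb]; exact ge_of_eq hq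
      refine ⟨x, (Set.ext_iff.1 hψb _).2 ?_, rfl⟩
      have hq : e.symm x.1.1.2 = d := hq
      change x.1.1.2 = -1
      rw [← he, ← hq, e.apply_symm_apply]
    · rintro ⟨x, hx, rfl⟩
      have hx : x.1.1.2 = -1 := (Set.ext_iff.1 hψb _).1 hx
      change e.symm x.1.1.2 = d
      rw [hx, hed]

/-- Reparametrizing the profile does not change the surface. -/
noncomputable def sheetedHomeomorph (h : ℂ → ℝ) (σ : ℝ → ℝ) (e : ℝ ≃ₜ ℝ) :
    sheeted h (σ ∘ e) ≃ₜ sheeted h σ :=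
  ((Homeomorph.refl ℂ).prodCongr e).subtype fun _ => Iff.rfl


/-! ### Chebyshev profiles -/

/-- The Chebyshev polynomial of the first kind, as a real function. -/
noncomputable def cheb (n : ℕ) (y : ℝ) : ℝ := (Polynomial.Chebyshev.T ℝ n).eval y

theorem contDiff_cheb (n : ℕ) : ContDiff ℝ ∞ (cheb n) := by
  have h : cheb n = fun y => Polynomial.aeval y (Polynomial.Chebyshev.T ℝ n) := by
    funext y; simp [cheb]
  rw [h]
  exact Polynomial.contDiff_aeval _ _

theorem continuous_cheb (n : ℕ) : Continuous (cheb n) := (contDiff_cheb n).continuous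

theorem cheb_cos (n : ℕ) (t : ℝ) : cheb n (Real.cos t) = Real.cos (n * t) := by
  exact_mod_cast T_real_cos t n

theorem cheb_one (n : ℕ) : cheb n 1 = 1 := by
  simpa using cheb_cos n 0

theorem cheb_neg (n : ℕ) (y : ℝ) : cheb n (-y) = (-1) ^ n * cheb n y := by
  simp [cheb, Polynomial.Chebyshev.T_eval_neg]

theorem cheb_node {n j : ℕ} (hj : j ≤ n) : cheb n (node n j) = (-1) ^ j := by
  simpa [cheb] using Polynomial.Chebyshev.eval_T_real_node (Finset.mem_Iic.2 hj)

theorem node_lt_node {n i j : ℕ} (hij : i < j) (hj : j ≤ n) : node n j < node n i :=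
  Polynomial.Chebyshev.node_lt hj hij

theorem neg_one_pow_mul_self (j : ℕ) : (-1 : ℝ) ^ j * (-1) ^ j = 1 := by
  rw [← mul_pow]; norm_num

/-- With `y = cos((t + jπ)/n)` and `t ∈ [0, π]`, the signed polynomial is `cos t`; both `y` and `cos
t` decrease in `t`. -/
theorem strictMonoOn_cheb_node {n j : ℕ} (hj : j < n) :
    StrictMonoOn (fun y => (-1) ^ j * cheb n y) (Icc (node n (j + 1)) (node n j)) := by
  have hn : (0 : ℝ) < n := by exact_mod_cast (Nat.zero_le j).trans_lt hj
  have key (y : ℝ) (hy : y ∈ Icc (node n (j + 1)) (node n j)) :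
      ∃ t ∈ Icc 0 Real.pi, y = Real.cos ((t + j * Real.pi) / n) ∧
        (-1) ^ j * cheb n y = Real.cos t := by
    obtain ⟨s, hs, rfl⟩ : ∃ s ∈ Icc (j * Real.pi / n) ((j + 1 : ℕ) * Real.pi / n),
        Real.cos s = y := by
      refine intermediate_value_Icc' ?_ Real.continuous_cos.continuousOn hy
      gcongr; simp
    have h1 := (div_le_iff₀ hn).1 hs.1
    have h2 := (le_div_iff₀ hn).1 hs.2
    push_cast at h2
    refine ⟨n * s - j * Real.pi, ⟨by linarith, by linarith⟩, ?_, ?_⟩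
    · congr 1; field_simp; ring
    · rw [cheb_cos, Real.cos_sub_nat_mul_pi]
  intro x hx y hy hxy
  obtain ⟨s, hs, rfl, hs'⟩ := key x hx
  obtain ⟨t, ht, rfl, ht'⟩ := key y hy
  change (-1) ^ j * cheb n _ < (-1) ^ j * cheb n _
  rw [hs', ht']
  refine Real.strictAntiOn_cos ht hs ?_
  by_contra! hst
  refine absurd hxy (not_lt_of_ge ?_)
  have hj' : (j : ℝ) + 1 ≤ n := by exact_mod_cast hj
  refine Real.cos_le_cos_of_nonneg_of_le_pi ?_ ?_ ?_
  · have := hs.1; positivity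
  · rw [div_le_iff₀ hn]; nlinarith [ht.2, Real.pi_pos]
  · gcongr

/-- Outside the oscillating range, `y = cosh s` turns the polynomial into `cosh (n s)`. -/
theorem strictMonoOn_cheb_Ici {n : ℕ} (hn : n ≠ 0) : StrictMonoOn (cheb n) (Ici 1) := by
  intro x hx y hy hxy
  rw [← Real.cosh_arcosh hx, ← Real.cosh_arcosh hy] at *
  simp only [cheb]
  have h1 := T_real_cosh (Real.arcosh x) n
  have h2 := T_real_cosh (Real.arcosh y) n
  rw [h1, h2]
  rw [Real.cosh_lt_cosh] at *
  have : (0 : ℝ) < |(n : ℝ)| := by positivity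
  rw [abs_mul, abs_mul]
  push_cast
  gcongr

theorem le_cheb {n : ℕ} (hn : n ≠ 0) {y : ℝ} (hy : 1 ≤ y) : y ≤ cheb n y := by
  rw [← Real.cosh_arcosh hy]
  have h1 := T_real_cosh (Real.arcosh y) n
  simp only [cheb]
  rw [h1, Real.cosh_le_cosh, abs_mul]
  refine le_mul_of_one_le_left (abs_nonneg _) ?_
  push_cast
  rw [Nat.abs_cast]
  exact_mod_cast Nat.one_le_iff_ne_zero.2 hn

theorem tendsto_cheb {n : ℕ} (hn : n ≠ 0) : Tendsto (cheb n) atTop atTop :=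
  tendsto_atTop_mono' _ ((eventually_ge_atTop 1).mono fun _ => le_cheb hn) tendsto_id

/-! ### Monotone profiles and their order isomorphisms -/

theorem exists_orderIso_of_strictMono {f : ℝ → ℝ} (hf : Continuous f) (hm : StrictMono f)
    (ht : Tendsto f atTop atTop) (hb : Tendsto f atBot atBot) : ∃ e : ℝ ≃o ℝ, ⇑e = f :=
  ⟨hm.orderIsoOfSurjective f (hf.surjective ht hb), rfl⟩

theorem exists_orderIso_of_strictMonoOn {f : ℝ → ℝ} {d : ℝ} (hf : Continuous f)
    (hm : StrictMonoOn f (Ici d)) (ht : Tendsto f atTop atTop) :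
    ∃ e : ℝ ≃o ℝ, ∀ y, d ≤ y → f y = e y := by
  -- Below `d` the function is replaced by the line of slope `1` through `(d, f d)`.
  obtain ⟨e, he⟩ : ∃ e : ℝ ≃o ℝ, ⇑e = fun y => f (max y d) + min (y - d) 0 := by
    refine exists_orderIso_of_strictMono (by fun_prop) ?_ ?_ ?_
    · intro x y hxy
      change f (max x d) + min (x - d) 0 < f (max y d) + min (y - d) 0
      have h1 : f (max x d) ≤ f (max y d) := hm.monotoneOn (mem_Ici.2 (le_max_right _ _))
        (mem_Ici.2 (le_max_right _ _))
        (max_le_max_right _ hxy.le)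
      have h2 : min (x - d) 0 ≤ min (y - d) 0 := min_le_min_right _ (by linarith)
      rcases le_or_gt d x with h | h
      · refine add_lt_add_of_lt_of_le (hm (mem_Ici.2 (le_max_right _ _))
          (mem_Ici.2 (le_max_right _ _)) ?_) h2
        rw [max_eq_left h, max_eq_left (h.trans hxy.le)]
        exact hxy
      · refine add_lt_add_of_le_of_lt h1 ?_
        rw [min_eq_left (by linarith : x - d ≤ 0)]
        exact lt_min (by linarith) (by linarith)
    · refine ht.congr' ((eventually_ge_atTop d).mono fun y hy => ?_)
      simp [hy]
    · have : Tendsto (fun y => f d + (y - d)) atBot atBot :=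
        tendsto_atBot_add_const_left _ _ (tendsto_atBot_add_const_right _ (-d) tendsto_id)
      refine this.congr' ((eventually_le_atBot d).mono fun y hy => ?_)
      simp [hy]
  refine ⟨e, fun y hy => ?_⟩
  rw [he]
  simp [hy]

/-- The Chebyshev polynomial (up to sign) below the node `j`, continued with slope `1`. -/
noncomputable def chebClamp (n j : ℕ) (y : ℝ) : ℝ :=
  (-1) ^ j * cheb n (min y (node n j)) + max (y - node n j) 0

theorem continuous_chebClamp (n j : ℕ) : Continuous (chebClamp n j) := by
  have := continuous_cheb n
  unfold chebClamp
  fun_prop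

theorem chebClamp_of_le {n j : ℕ} {y : ℝ} (hy : y ≤ node n j) :
    chebClamp n j y = (-1) ^ j * cheb n y := by
  simp [chebClamp, hy]

theorem chebClamp_of_ge {n j : ℕ} (hj : j ≤ n) {y : ℝ} (hy : node n j ≤ y) :
    chebClamp n j y = 1 + (y - node n j) := by
  simp [chebClamp, hy, cheb_node hj, neg_one_pow_mul_self]

theorem strictMonoOn_chebClamp_Ici {n j : ℕ} (hj : j ≤ n) :
    StrictMonoOn (chebClamp n j) (Ici (node n j)) := by
  intro x hx y hy hxy
  rw [chebClamp_of_ge hj hx, chebClamp_of_ge hj hy]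
  linarith

theorem tendsto_chebClamp {n j : ℕ} (hj : j ≤ n) : Tendsto (chebClamp n j) atTop atTop := by
  have : Tendsto (fun y => 1 + (y - node n j)) atTop atTop :=
    tendsto_atTop_add_const_left _ _ (tendsto_atTop_add_const_right _ (-node n j) tendsto_id)
  exact this.congr' ((eventually_ge_atTop (node n j)).mono fun y hy => (chebClamp_of_ge hj hy).symm)

theorem strictMonoOn_chebClamp {n j : ℕ} (hj : j < n) :
    StrictMonoOn (chebClamp n j) (Ici (node n (j + 1))) := by
  have h := (node_lt_node (Nat.lt_succ_self j) hj).le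
  rw [← Icc_union_Ici_eq_Ici h]
  refine StrictMonoOn.union ?_ (strictMonoOn_chebClamp_Ici hj.le) (isGreatest_Icc h) isLeast_Ici
  exact (strictMonoOn_cheb_node hj).congr fun y hy => (chebClamp_of_le hy.2).symm

theorem neg_one_pow_pred_mul_cheb {n : ℕ} (y : ℝ) :
    (-1) ^ n * cheb (n + 1) y = -cheb (n + 1) (-y) := by
  rw [cheb_neg, pow_succ]; ring

/-- Clamping at the last interior critical height leaves no turning point: the lowest branch of the
polynomial is monotone up to that height and the line continues it. -/
theorem exists_orderIso_chebClamp (n : ℕ) : ∃ e : ℝ ≃o ℝ, ⇑e = chebClamp (n + 1) n := by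
  have hn : node (n + 1) (n + 1) = -1 := node_eq_neg_one n.succ_ne_zero
  have hle : -1 ≤ node (n + 1) n := by
    rw [← hn]; exact (node_lt_node (Nat.lt_succ_self n) le_rfl).le
  refine exists_orderIso_of_strictMono (continuous_chebClamp _ _) ?_
    (tendsto_chebClamp n.le_succ) ?_
  · have h1 : StrictMonoOn (chebClamp (n + 1) n) (Ici (-1)) :=
      hn ▸ strictMonoOn_chebClamp (Nat.lt_succ_self n)
    refine StrictMonoOn.Iic_union_Ici ?_ h1
    intro x hx y hy hxy
    have hx : x ≤ -1 := hx
    have hy : y ≤ -1 := hy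
    rw [chebClamp_of_le (hx.trans hle), chebClamp_of_le (hy.trans hle),
      neg_one_pow_pred_mul_cheb, neg_one_pow_pred_mul_cheb, neg_lt_neg_iff]
    exact strictMonoOn_cheb_Ici n.succ_ne_zero (by change 1 ≤ -y; linarith)
      (by change 1 ≤ -x; linarith) (by linarith)
  · have h := tendsto_neg_atTop_atBot.comp ((tendsto_cheb n.succ_ne_zero).comp
      tendsto_neg_atBot_atTop)
    refine h.congr' ((eventually_le_atBot (-1)).mono fun y hy => ?_)
    rw [chebClamp_of_le (hy.trans hle), neg_one_pow_pred_mul_cheb]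
    rfl

/-! ### Counting the genus -/

theorem isClosedSurfaceOfGenus_one {h : ℂ → ℝ} {c : ℂ} {ε : ℝ} (hh : IsPillar h c ε)
    (Θ : sheeted h id ≃ₜ Circle × Circle) : IsClosedSurfaceOfGenus 1 (sheeted h id) := by
  obtain ⟨φ, hφ, -, -⟩ := exists_isEmbeddedDisc_id hh
  exact ⟨_, _, ⟨Homeomorph.refl _⟩, (isConnectedSum_sphere hφ).congr_second Θ⟩

/-- Induction on the number of monotone branches kept: moving the clamp from node `j + 1` up to node
`j` replaces a cap by one more torus minus a disc. With a single branch the profile is a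
reparametrization of the identity. -/
theorem isClosedSurfaceOfGenus_chebClamp {h : ℂ → ℝ} {c : ℂ} {ε : ℝ} (hh : IsPillar h c ε)
    (Θ : sheeted h id ≃ₜ Circle × Circle) {n : ℕ} :
    ∀ {k j : ℕ}, k + 1 + j = n → IsClosedSurfaceOfGenus (k + 1) (sheeted h (chebClamp n j))
  | 0, j, hj => by
    obtain rfl : n = j + 1 := by omega
    obtain ⟨e, he⟩ := exists_orderIso_chebClamp j
    rw [← he]
    exact (isClosedSurfaceOfGenus_one hh Θ).congr (sheetedHomeomorph h id e.toHomeomorph).symm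
  | k + 1, j, hj => by
    have : CompactSpace (sheeted h id) := Θ.symm.compactSpace
    have hjn : j < n := by omega
    have hlt := node_lt_node (Nat.lt_succ_self j) hjn
    obtain ⟨e, he⟩ := exists_orderIso_of_strictMonoOn (continuous_chebClamp n j)
      (strictMonoOn_chebClamp hjn) (tendsto_chebClamp hjn.le)
    refine ⟨_, _, isClosedSurfaceOfGenus_chebClamp (n := n) hh Θ (k := k) (j := j + 1) (by omega),
      IsConnectedSum.congr_second Θ ?_⟩
    refine isConnectedSum_sheeted hh (continuous_chebClamp _ _) (continuous_chebClamp _ _)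
      (d := node n (j + 1)) ?_ ?_ e ?_ he
    · intro y hy
      -- Below node `j + 1` the two profiles differ only by a sign, and only their squares enter.
      rw [chebClamp_of_le hy, chebClamp_of_le (hy.trans hlt.le), pow_succ]
      ring
    · intro y hy
      exact chebClamp_of_ge hjn hy
    · rw [← he _ le_rfl, chebClamp_of_le hlt.le, cheb_node hjn, pow_succ, ← mul_assoc,
        neg_one_pow_mul_self]
      norm_num

theorem isClosedSurfaceOfGenus_cheb {h : ℂ → ℝ} {c : ℂ} {ε : ℝ} (hh : IsPillar h c ε)
    (Θ : sheeted h id ≃ₜ Circle × Circle) {n : ℕ} (hn : 1 ≤ n) :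
    IsClosedSurfaceOfGenus n (sheeted h (cheb n)) := by
  -- Clamping at node `0`, which is `1`, alters only the monotone end `y ≥ 1`; the map `e` below
  -- undoes this by sending `y ≥ 1` to the value of the polynomial at `y`.
  obtain ⟨k, rfl⟩ : ∃ k, n = k + 1 := ⟨n - 1, by omega⟩
  obtain ⟨e, he⟩ : ∃ e : ℝ ≃o ℝ, ⇑e = fun y => min y 1 + (cheb (k + 1) (max y 1) - 1) := by
    refine exists_orderIso_of_strictMono (by have := continuous_cheb (k + 1); fun_prop) ?_ ?_ ?_
    · refine StrictMonoOn.Iic_union_Ici (a := 1) ?_ ?_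
      · intro x hx y hy hxy
        have hx : x ≤ 1 := hx
        have hy : y ≤ 1 := hy
        simpa [hx, hy] using hxy
      · intro x hx y hy hxy
        have := strictMonoOn_cheb_Ici k.succ_ne_zero hx hy hxy
        have hx : 1 ≤ x := hx
        have hy : 1 ≤ y := hy
        simpa [hx, hy] using this
    · refine (tendsto_cheb k.succ_ne_zero).congr' ((eventually_ge_atTop 1).mono fun y hy => ?_)
      simp [hy]
    · refine tendsto_id.congr' ((eventually_le_atBot 1).mono fun y hy => ?_)
      simp [hy, cheb_one]
  have h1 : chebClamp (k + 1) 0 ∘ e.toHomeomorph = cheb (k + 1) := by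
    funext y
    change chebClamp (k + 1) 0 (e y) = _
    rw [he]
    rcases le_total y 1 with hy | hy
    · rw [chebClamp_of_le]
      · simp [hy, cheb_one]
      · simp [hy, cheb_one, node_eq_one]
    · have := le_cheb k.succ_ne_zero hy
      rw [chebClamp_of_ge (Nat.zero_le _)]
      · simp [hy, node_eq_one]
      · simp only [hy, node_eq_one, min_eq_right, max_eq_left]
        linarith
  rw [← h1]
  exact (isClosedSurfaceOfGenus_chebClamp hh Θ (n := k + 1) (add_zero _)).congr
    (sheetedHomeomorph h _ e.toHomeomorph).symm


/-! ### The height function -/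

/-- `ζ² = baseHeight ξ` is a torus of revolution. -/
noncomputable def baseHeight (ξ : ℂ) : ℝ := (1 - (‖ξ‖ ^ 2 - 2) ^ 2) / 2

/-- A quadratic function which is at least `1` on the disc with centre `c` and radius `ε`. -/
noncomputable def peak (c : ℂ) (ε : ℝ) (ξ : ℂ) : ℝ := 1 + ε ^ 2 - ‖ξ - c‖ ^ 2

/-- A cutoff function around `c`. -/
def cutoff (c : ℂ) {ε : ℝ} (hε : 0 < ε) : ContDiffBump c where
  rIn := 2 * ε
  rOut := 3 * ε
  rIn_pos := by positivity
  rIn_lt_rOut := by linarith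

/-- The function `baseHeight`, modified to be `peak` near `c`. -/
noncomputable def height (c : ℂ) {ε : ℝ} (hε : 0 < ε) (ξ : ℂ) : ℝ :=
  baseHeight ξ + cutoff c hε ξ * (peak c ε ξ - baseHeight ξ)

theorem contDiff_baseHeight : ContDiff ℝ ∞ baseHeight := by
  have := contDiff_norm_sq ℝ (E := ℂ) (n := ∞)
  unfold baseHeight
  fun_prop

theorem contDiff_peak (c : ℂ) (ε : ℝ) : ContDiff ℝ ∞ (peak c ε) :=
  contDiff_const.sub ((contDiff_norm_sq ℝ).comp (contDiff_id.sub contDiff_const))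

theorem baseHeight_le (ξ : ℂ) : baseHeight ξ ≤ 1 / 2 := by
  unfold baseHeight
  nlinarith [sq_nonneg (‖ξ‖ ^ 2 - 2)]

section Height

variable {c : ℂ} {ε : ℝ} (hε : 0 < ε)

theorem contDiff_height : ContDiff ℝ ∞ (height c hε) :=
  contDiff_baseHeight.add ((cutoff c hε).contDiff.mul ((contDiff_peak c ε).sub contDiff_baseHeight))

theorem height_of_le {ξ : ℂ} (hξ : ‖ξ - c‖ ≤ 2 * ε) : height c hε ξ = peak c ε ξ := by
  rw [height, (cutoff c hε).one_of_mem_closedBall (mem_closedBall_iff_norm.2 hξ)]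
  ring

theorem height_of_ge {ξ : ℂ} (hξ : 3 * ε ≤ ‖ξ - c‖) : height c hε ξ = baseHeight ξ := by
  rw [height, (cutoff c hε).zero_of_le_dist (by rwa [dist_eq_norm])]
  ring

/-- `height` is a convex combination of `peak` and `baseHeight`, both of which are below `1` outside
the disc of radius `ε`, so no value at least `1` arises in the transition zone. -/
theorem height_lt_one {ξ : ℂ} (hξ : ε < ‖ξ - c‖) : height c hε ξ < 1 := by
  have h1 : peak c ε ξ < 1 := by
    unfold peak
    nlinarith
  have h2 := baseHeight_le ξ
  have h3 := (cutoff c hε).nonneg (x := ξ)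
  have h4 := (cutoff c hε).le_one (x := ξ)
  have h5 : cutoff c hε ξ * (peak c ε ξ - 1) ≤ 0 := by nlinarith
  have h6 : (1 - cutoff c hε ξ) * (baseHeight ξ - 1) ≤ 0 := by nlinarith
  have h7 : height c hε ξ - 1 =
      cutoff c hε ξ * (peak c ε ξ - 1) + (1 - cutoff c hε ξ) * (baseHeight ξ - 1) := by
    unfold height; ring
  by_contra! h
  have h8 : cutoff c hε ξ * (peak c ε ξ - 1) = 0 := by linarith
  have h9 : (1 - cutoff c hε ξ) * (baseHeight ξ - 1) = 0 := by linarith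
  rcases mul_eq_zero.1 h8 with h | h <;> rcases mul_eq_zero.1 h9 with h' | h' <;> linarith

theorem one_le_height_iff (ξ : ℂ) : 1 ≤ height c hε ξ ↔ ‖ξ - c‖ ≤ ε := by
  constructor
  · intro h
    by_contra! h'
    exact absurd (height_lt_one hε h') (not_lt_of_ge h)
  · intro h
    rw [height_of_le hε (by linarith), peak]
    nlinarith [norm_nonneg (ξ - c)]

theorem isPillar_height : IsPillar (height c hε) c ε where
  continuous := (contDiff_height hε).continuous
  pos := hε
  one_le_iff := one_le_height_iff hε
  one_lt_iff ξ := by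
    constructor
    · intro h
      have h' := (one_le_height_iff hε ξ).1 h.le
      rw [height_of_le hε (by linarith), peak] at h
      nlinarith [norm_nonneg (ξ - c)]
    · intro h
      rw [height_of_le hε (by linarith), peak]
      nlinarith [norm_nonneg (ξ - c)]

theorem height_le (ξ : ℂ) : height c hε ξ ≤ 1 + ε ^ 2 := by
  have h1 : peak c ε ξ ≤ 1 + ε ^ 2 := by
    unfold peak
    nlinarith [sq_nonneg ‖ξ - c‖]
  have h2 := baseHeight_le ξ
  have h3 := (cutoff c hε).nonneg (x := ξ)
  have h4 := (cutoff c hε).le_one (x := ξ)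
  unfold height
  nlinarith [mul_nonneg h3 (sub_nonneg.2 h1), mul_nonneg (sub_nonneg.2 h4) (sub_nonneg.2 h2),
    mul_nonneg (sub_nonneg.2 h4) (sq_nonneg ε)]

/-- The bound `1/20` gives `3ε ≤ 3/20`; together with `‖c‖ ≤ 3/2` this keeps the modified disc well
inside the annulus where `baseHeight` is positive. -/
theorem abs_norm_sq_sub_two_le (hc : ‖c‖ ^ 2 = 2) (hε' : ε ≤ 1 / 20) {ξ : ℂ}
    (hξ : ‖ξ - c‖ ≤ 3 * ε) : |‖ξ‖ ^ 2 - 2| ≤ 1 / 2 := by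
  have h1 := abs_norm_sub_norm_le ξ c
  have h2 : ‖c‖ ≤ 3 / 2 := by nlinarith [norm_nonneg c]
  rw [abs_le] at *
  constructor <;> nlinarith [norm_nonneg c, norm_nonneg ξ]

theorem baseHeight_pos_of_le (hc : ‖c‖ ^ 2 = 2) (hε' : ε ≤ 1 / 20) {ξ : ℂ}
    (hξ : ‖ξ - c‖ ≤ 3 * ε) : 0 < baseHeight ξ := by
  have := abs_le.1 (abs_norm_sq_sub_two_le hc hε' hξ)
  unfold baseHeight
  nlinarith

theorem peak_pos_of_le {c : ℂ} {ε : ℝ} (hε : 0 < ε) (hε' : ε ≤ 1 / 20) {ξ : ℂ}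
    (hξ : ‖ξ - c‖ ≤ 3 * ε) : 0 < peak c ε ξ := by
  unfold peak
  nlinarith [norm_nonneg (ξ - c)]

theorem height_pos_of_le (hc : ‖c‖ ^ 2 = 2) (hε' : ε ≤ 1 / 20) {ξ : ℂ}
    (hξ : ‖ξ - c‖ ≤ 3 * ε) : 0 < height c hε ξ := by
  have h1 := baseHeight_pos_of_le hc hε' hξ
  have h2 := peak_pos_of_le hε hε' hξ
  have h3 := (cutoff c hε).nonneg (x := ξ)
  have h4 := (cutoff c hε).le_one (x := ξ)
  have : height c hε ξ = (1 - cutoff c hε ξ) * baseHeight ξ + cutoff c hε ξ * peak c ε ξ := by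
    unfold height; ring
  rw [this]
  rcases h3.eq_or_lt with h | h
  · rw [← h]; linarith
  · nlinarith [mul_pos h h2, mul_nonneg (sub_nonneg.2 h4) h1.le]

theorem norm_le_of_height_nonneg (hc : ‖c‖ ^ 2 = 2) (hε' : ε ≤ 1 / 20) {ξ : ℂ}
    (h : 0 ≤ height c hε ξ) : ‖ξ‖ ≤ 2 := by
  rcases le_total ‖ξ - c‖ (3 * ε) with h1 | h1
  · have := abs_le.1 (abs_norm_sq_sub_two_le hc hε' h1)
    nlinarith
  · rw [height_of_ge hε h1, baseHeight] at h
    by_contra! h2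
    have : 2 < ‖ξ‖ ^ 2 - 2 := by nlinarith
    nlinarith

/-- On the modified disc `height` is positive, so near a zero it is `baseHeight`; the value `1`
occurs only at distance `ε` from `c`, where it is `peak`. Each of these has nonzero radial
derivative there, about `0` and about `c` respectively. -/
theorem fderiv_height_ne_zero (hc : ‖c‖ ^ 2 = 2) (hε' : ε ≤ 1 / 20) {ξ : ℂ}
    (h : height c hε ξ = 0 ∨ height c hε ξ = 1) :
    fderiv ℝ (height c hε) ξ ≠ 0 := by
  rcases h with h | h
  · have h1 : 3 * ε < ‖ξ - c‖ := by
      by_contra! h1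
      exact (height_pos_of_le hε hc hε' h1).ne' h
    have hev : height c hε =ᶠ[𝓝 ξ] baseHeight := by
      have : ∀ᶠ η in 𝓝 ξ, 3 * ε < ‖η - c‖ :=
        (continuous_id.sub continuous_const).norm.continuousAt.eventually (lt_mem_nhds h1)
      exact this.mono fun η hη => height_of_ge hε hη.le
    rw [hev.fderiv_eq]
    have hd : HasFDerivAt baseHeight _ ξ :=
      ((((hasStrictFDerivAt_norm_sq ξ).hasFDerivAt.sub_const (2 : ℝ)).pow 2).const_sub 1).mul_const
        (1 / 2 : ℝ) |>.congr_of_eventuallyEq (Eventually.of_forall fun η => by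
          simp [baseHeight, div_eq_mul_inv])
    rw [hd.fderiv]
    intro h2
    have h3 := congrArg (fun L : ℂ →L[ℝ] ℝ => L ξ) h2
    simp at h3
    rw [hev.eq_of_nhds, baseHeight] at h
    -- A zero of `baseHeight` has `‖ξ‖²` equal to `1` or `3`, which excludes both ways in which the
    -- radial derivative could vanish.
    have h4 : (‖ξ‖ ^ 2 - 2) ^ 2 = 1 := by linarith
    rcases h3 with h3 | h3
    · rw [h3] at h4; norm_num at h4
    · rw [h3] at h4; norm_num at h4
  · have h1 : ‖ξ - c‖ = ε := by
      refine le_antisymm ((one_le_height_iff hε ξ).1 h.ge) ?_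
      by_contra! h1
      exact ((isPillar_height hε).one_lt_iff ξ |>.2 h1).ne' h
    have hev : height c hε =ᶠ[𝓝 ξ] peak c ε := by
      have : ∀ᶠ η in 𝓝 ξ, ‖η - c‖ < 2 * ε :=
        (continuous_id.sub continuous_const).norm.continuousAt.eventually
          (gt_mem_nhds (by change ‖ξ - c‖ < _; linarith))
      exact this.mono fun η hη => height_of_le hε hη.le
    rw [hev.fderiv_eq]
    have hd : HasFDerivAt (peak c ε) _ ξ :=
      (((hasFDerivAt_id ξ).sub_const c).norm_sq).const_sub (1 + ε ^ 2)
    rw [hd.fderiv]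
    intro h2
    have h3 := congrArg (fun L : ℂ →L[ℝ] ℝ => L (ξ - c)) h2
    have h4 : -(2 * ‖ξ - c‖ ^ 2) = 0 := by
      simp [-Complex.inner, -inner_self_eq_norm_sq_to_K] at h3
      rw [← real_inner_self_eq_norm_sq, inner_sub_left]
      linarith
    rw [h1] at h4
    nlinarith

/-- The ratio of `height` and `baseHeight`. -/
theorem exists_height_ratio (hc : ‖c‖ ^ 2 = 2) (hε' : ε ≤ 1 / 20) :
    ∃ M : ℂ → ℝ, Continuous M ∧ (∀ ξ, 0 < M ξ) ∧
    ∀ ξ, height c hε ξ = M ξ * baseHeight ξ := by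
  have hz {ξ : ℂ} (hξ : ¬ ‖ξ - c‖ ≤ 3 * ε) : cutoff c hε ξ = 0 :=
    (cutoff c hε).zero_of_le_dist (by rw [dist_eq_norm]; exact (not_le.1 hξ).le)
  -- The quotient is only formed where the cutoff can be nonzero; there `baseHeight` is positive.
  -- Elsewhere the ratio is `1`, even at zeros of `baseHeight`.
  refine ⟨fun ξ => 1 + cutoff c hε ξ * (peak c ε ξ / baseHeight ξ - 1), ?_, ?_, ?_⟩
  · rw [continuous_iff_continuousAt]
    intro ξ
    by_cases hξ : ‖ξ - c‖ ≤ 3 * ε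
    · have := (baseHeight_pos_of_le hc hε' hξ).ne'
      exact continuousAt_const.add ((cutoff c hε).continuous.continuousAt.mul
        (((contDiff_peak c ε).continuous.continuousAt.div
          contDiff_baseHeight.continuous.continuousAt this).sub continuousAt_const))
    · have : ∀ᶠ η in 𝓝 ξ, 3 * ε < ‖η - c‖ :=
        (continuous_id.sub continuous_const).norm.continuousAt.eventually
          (lt_mem_nhds (not_le.1 hξ))
      refine (continuousAt_const (y := (1 : ℝ))).congr (this.mono fun η hη => ?_)
      simp [hz (not_le.2 hη)]
  · intro ξ
    by_cases hξ : ‖ξ - c‖ ≤ 3 * ε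
    · have h1 := div_pos (peak_pos_of_le hε hε' hξ) (baseHeight_pos_of_le hc hε' hξ)
      have h3 := (cutoff c hε).nonneg (x := ξ)
      have h4 := (cutoff c hε).le_one (x := ξ)
      rcases h3.eq_or_lt with h | h
      · simp [← h]
      · change 0 < 1 + cutoff c hε ξ * (peak c ε ξ / baseHeight ξ - 1)
        nlinarith [mul_pos h h1]
    · simp [hz hξ]
  · intro ξ
    by_cases hξ : ‖ξ - c‖ ≤ 3 * ε
    · have := (baseHeight_pos_of_le hc hε' hξ).ne'
      simp only [height]
      field_simp
    · simp [height, hz hξ]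

end Height

/-- The standard parametrization of the torus `ζ² = baseHeight ξ`. -/
noncomputable def torusParam (p : Circle × Circle) : sheeted baseHeight id :=
  ⟨(√(2 + (p.2 : ℂ).re) * (p.1 : ℂ), (p.2 : ℂ).im / √2), by
    have h1 : (p.2 : ℂ).re ^ 2 + (p.2 : ℂ).im ^ 2 = 1 := by
      have := Circle.normSq_coe p.2
      rw [Complex.normSq_apply] at this
      linarith
    have h2 : 0 ≤ 2 + (p.2 : ℂ).re := by nlinarith
    change ((p.2 : ℂ).im / √2) ^ 2 = (1 - (‖(√(2 + (p.2 : ℂ).re) : ℂ) * (p.1 : ℂ)‖ ^ 2 - 2) ^ 2) / 2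
    rw [norm_mul, Circle.norm_coe, mul_one, Complex.norm_real, Real.norm_eq_abs, sq_abs,
      Real.sq_sqrt h2, div_pow, Real.sq_sqrt zero_le_two]
    linarith⟩

theorem two_add_re_pos (z : Circle) : 0 < 2 + (z : ℂ).re := by
  have := (abs_le.1 ((Complex.abs_re_le_norm z).trans_eq (Circle.norm_coe z))).1
  linarith

theorem continuous_torusParam : Continuous torusParam := by
  refine Continuous.subtype_mk (Continuous.prodMk ?_ ?_) _
  · have : Continuous fun p : Circle × Circle => √(2 + (p.2 : ℂ).re) :=
      (continuous_const.add (Complex.continuous_re.comp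
        (continuous_subtype_val.comp continuous_snd))).sqrt
    exact (Complex.continuous_ofReal.comp this).mul (continuous_subtype_val.comp continuous_fst)
  · exact (Complex.continuous_im.comp (continuous_subtype_val.comp continuous_snd)).div_const _

theorem bijective_torusParam : Function.Bijective torusParam := by
  constructor
  · rintro ⟨e, f⟩ ⟨e', f'⟩ h
    have h1 : (√(2 + (f : ℂ).re) : ℂ) * (e : ℂ) = (√(2 + (f' : ℂ).re) : ℂ) * (e' : ℂ) :=
      congrArg (fun q : sheeted baseHeight id => q.1.1) h
    have h2 : (f : ℂ).im / √2 = (f' : ℂ).im / √2 :=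
      congrArg (fun q : sheeted baseHeight id => q.1.2) h
    have h3 : √(2 + (f : ℂ).re) = √(2 + (f' : ℂ).re) := by
      have := congrArg (fun z : ℂ => ‖z‖) h1
      simpa only [norm_mul, Circle.norm_coe, mul_one, Complex.norm_real, Real.norm_eq_abs,
        abs_of_nonneg (Real.sqrt_nonneg _)] using this
    have h4 : √(2 + (f : ℂ).re) ≠ 0 := (Real.sqrt_pos.2 (two_add_re_pos f)).ne'
    have h5 : (f : ℂ).re = (f' : ℂ).re := by
      have := (Real.sqrt_inj (two_add_re_pos f).le (two_add_re_pos f').le).1 h3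
      linarith
    rw [← h3] at h1
    have h6 : (e : ℂ) = e' := mul_left_cancel₀ (Complex.ofReal_ne_zero.2 h4) h1
    have h7 : (f : ℂ).im = (f' : ℂ).im := by
      have : √(2 : ℝ) ≠ 0 := by positivity
      field_simp at h2
      exact h2
    exact Prod.ext (Circle.ext h6) (Circle.ext (Complex.ext h5 h7))
  · rintro ⟨⟨ξ, ζ⟩, hq⟩
    have hq' : ζ ^ 2 = (1 - (‖ξ‖ ^ 2 - 2) ^ 2) / 2 := hq
    have hξ : 0 < ‖ξ‖ := by
      refine (norm_nonneg ξ).lt_of_ne fun h => ?_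
      rw [← h] at hq'
      nlinarith [sq_nonneg ζ]
    have hs : √2 ^ 2 = (2 : ℝ) := Real.sq_sqrt zero_le_two
    -- The equation of the torus says that `(‖ξ‖² - 2, √2 ζ)` lies on the unit circle: this is the
    -- second angle, the first being `ξ / ‖ξ‖`.
    have hf : (⟨‖ξ‖ ^ 2 - 2, √2 * ζ⟩ : ℂ) ∈ Submonoid.unitSphere ℂ := by
      rw [Submonoid.unitSphere, ← SetLike.mem_coe, Submonoid.coe_set_mk,
        Subsemigroup.coe_set_mk, mem_sphere_zero_iff_norm, ← sq_eq_sq₀ (norm_nonneg _) zero_le_one,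
        Complex.sq_norm,
        Complex.normSq_mk]
      linear_combination ζ ^ 2 * hs + 2 * hq'
    have he : ξ / ‖ξ‖ ∈ Submonoid.unitSphere ℂ := by
      rw [Submonoid.unitSphere, ← SetLike.mem_coe, Submonoid.coe_set_mk,
        Subsemigroup.coe_set_mk, mem_sphere_zero_iff_norm, norm_div, Complex.norm_real, norm_norm,
        div_self hξ.ne']
    refine ⟨(⟨_, he⟩, ⟨_, hf⟩), Subtype.ext (Prod.ext ?_ ?_)⟩
    · change (√(2 + (‖ξ‖ ^ 2 - 2)) : ℂ) * (ξ / ‖ξ‖) = ξ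
      rw [add_sub_cancel, Real.sqrt_sq hξ.le, mul_div_cancel₀ _ (Complex.ofReal_ne_zero.2 hξ.ne')]
    · change √2 * ζ / √2 = ζ
      field_simp

/-- The surface `ζ² = baseHeight ξ` is a torus. -/
noncomputable def torusHomeomorph : Circle × Circle ≃ₜ sheeted baseHeight id :=
  Continuous.homeoOfEquivCompactToT2 (f := Equiv.ofBijective _ bijective_torusParam)
    continuous_torusParam

/-- Since `height` is a positive continuous multiple `M` of `baseHeight`, rescaling `ζ` by `√M`
carries one surface to the other: with the identity profile the bump does not change the topology.
-/
theorem nonempty_homeomorph_height {c : ℂ} {ε : ℝ} (hε : 0 < ε) (hc : ‖c‖ ^ 2 = 2)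
    (hε' : ε ≤ 1 / 20) : Nonempty (sheeted (height c hε) id ≃ₜ Circle × Circle) := by
  obtain ⟨M, hM, hM0, hMh⟩ := exists_height_ratio hε hc hε'
  have hs (ξ : ℂ) : √(M ξ) ≠ 0 := (Real.sqrt_pos.2 (hM0 ξ)).ne'
  let E : ℂ × ℝ ≃ₜ ℂ × ℝ :=
    { toFun := fun q => (q.1, √(M q.1) * q.2)
      invFun := fun q => (q.1, q.2 / √(M q.1))
      left_inv := fun q => Prod.ext rfl (mul_div_cancel_left₀ _ (hs _))
      right_inv := fun q => Prod.ext rfl (mul_div_cancel₀ _ (hs _))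
      continuous_toFun := by fun_prop
      continuous_invFun := by fun_prop (disch := exact fun _ => hs _) }
  have key : sheeted baseHeight id ≃ₜ sheeted (height c hε) id := E.subtype fun q => by
    change q.2 ^ 2 = baseHeight q.1 ↔ (√(M q.1) * q.2) ^ 2 = height c hε q.1
    rw [hMh, mul_pow, Real.sq_sqrt (hM0 _).le, mul_right_inj' (hM0 _).ne']
  exact ⟨(torusHomeomorph.trans key).symm⟩


/-! ### The profile of the upper torus -/

/-- The height, on the upper branch of `cheb n`, at which `cheb n` is `√(1/2) sin φ`. -/
noncomputable def leafHeight (n : ℕ) (φ : ℝ) : ℝ :=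
  Real.cos (Real.arccos (√(1 / 2) * Real.sin φ) / n)

/-- The strict inequality keeps the torus away from the critical heights and `arccos` inside the
range where it is smooth. -/
theorem abs_sqrt_half_mul_sin_lt (φ : ℝ) : |√(1 / 2) * Real.sin φ| < 1 := by
  rw [abs_mul, abs_of_nonneg (Real.sqrt_nonneg _)]
  have h1 : √(1 / 2 : ℝ) < 1 := by
    rw [Real.sqrt_lt' zero_lt_one]; norm_num
  exact (mul_le_of_le_one_right (Real.sqrt_nonneg _) (Real.abs_sin_le_one φ)).trans_lt h1

theorem cheb_leafHeight {n : ℕ} (hn : n ≠ 0) (φ : ℝ) :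
    cheb n (leafHeight n φ) = √(1 / 2) * Real.sin φ := by
  have h := abs_lt.1 (abs_sqrt_half_mul_sin_lt φ)
  rw [leafHeight, cheb_cos, mul_div_cancel₀ _ (Nat.cast_ne_zero.2 hn),
    Real.cos_arccos h.1.le h.2.le]

theorem node_one_lt_leafHeight {n : ℕ} (hn : n ≠ 0) (φ : ℝ) : node n 1 < leafHeight n φ := by
  have hn' : (1 : ℝ) ≤ n := by exact_mod_cast Nat.one_le_iff_ne_zero.2 hn
  have h := abs_lt.1 (abs_sqrt_half_mul_sin_lt φ)
  have h1 : Real.arccos (√(1 / 2) * Real.sin φ) < Real.pi :=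
    (Real.arccos_le_pi _).lt_of_ne fun h' => by
      rw [Real.arccos_eq_pi] at h'; linarith
  rw [node, leafHeight]
  refine Real.strictAntiOn_cos ⟨?_, ?_⟩ ⟨?_, ?_⟩ ?_
  · exact div_nonneg (Real.arccos_nonneg _) (by linarith)
  · exact (div_le_self (Real.arccos_nonneg _) hn').trans (Real.arccos_le_pi _)
  · have := Real.pi_pos; positivity
  · rw [Nat.cast_one, one_mul]; exact div_le_self Real.pi_pos.le hn'
  · rw [Nat.cast_one, one_mul]; gcongr

theorem strictMonoOn_cheb {n : ℕ} (hn : n ≠ 0) : StrictMonoOn (cheb n) (Ici (node n 1)) := by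
  have h := node_lt_node (n := n) zero_lt_one (Nat.one_le_iff_ne_zero.2 hn)
  rw [node_eq_one] at h
  rw [← Icc_union_Ici_eq_Ici h.le]
  refine StrictMonoOn.union ?_ (strictMonoOn_cheb_Ici hn) (isGreatest_Icc h.le) isLeast_Ici
  have := strictMonoOn_cheb_node (Nat.pos_of_ne_zero hn)
  simpa [node_eq_one] using this

theorem contDiff_leafHeight (n : ℕ) : ContDiff ℝ ∞ (leafHeight n) := by
  refine Real.contDiff_cos.comp (ContDiff.div_const ?_ _)
  rw [contDiff_iff_contDiffAt]
  intro φ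
  have h := abs_lt.1 (abs_sqrt_half_mul_sin_lt φ)
  exact ContDiffAt.comp (g := Real.arccos) φ (Real.contDiffAt_arccos h.1.ne' h.2.ne)
    (contDiff_const.mul Real.contDiff_sin).contDiffAt

theorem leafHeight_add_two_pi (n : ℕ) (φ : ℝ) :
    leafHeight n (φ + 2 * Real.pi) = leafHeight n φ := by
  simp [leafHeight]

/-- On the top branch the polynomial is increasing, so `leafHeight` is an increasing function of
`sin φ`. -/
theorem leafHeight_sub_mul_sin_nonneg {n : ℕ} (hn : n ≠ 0) (φ : ℝ) :
    0 ≤ (leafHeight n φ - leafHeight n 0) * Real.sin φ := by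
  have h1 := cheb_leafHeight hn φ
  have h2 := cheb_leafHeight hn 0
  have h3 := (strictMonoOn_cheb hn).le_iff_le (node_one_lt_leafHeight hn φ).le
    (node_one_lt_leafHeight hn 0).le
  have h4 := (strictMonoOn_cheb hn).le_iff_le (node_one_lt_leafHeight hn 0).le
    (node_one_lt_leafHeight hn φ).le
  have h5 : 0 < √(1 / 2 : ℝ) := by positivity
  rw [h1, h2, Real.sin_zero, mul_zero] at h3 h4
  rcases le_total 0 (Real.sin φ) with h | h
  · exact mul_nonneg (sub_nonneg.2 (h4.1 (by positivity))) h
  · exact mul_nonneg_of_nonpos_of_nonpos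
      (sub_nonpos.2 (h3.1 (mul_nonpos_of_nonneg_of_nonpos h5.le h))) h

theorem leafHeight_zero_lt {n : ℕ} (hn : n ≠ 0) :
    leafHeight n 0 < leafHeight n (Real.pi / 2) := by
  rw [← (strictMonoOn_cheb hn).lt_iff_lt (node_one_lt_leafHeight hn _).le
    (node_one_lt_leafHeight hn _).le, cheb_leafHeight hn, cheb_leafHeight hn]
  simp

theorem two_add_cos_pos (φ : ℝ) : 0 < 2 + Real.cos φ := by
  linarith [Real.neg_one_le_cos φ]

/-- The derivative of `leafAngle`. -/
noncomputable def leafSlope (n : ℕ) (φ : ℝ) : ℝ := 2 / (2 + Real.cos φ) * deriv (leafHeight n) φ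

/-- Minus the angle turned by a horizontal curve on the torus with profile `leafHeight n`. -/
noncomputable def leafAngle (n : ℕ) (φ : ℝ) : ℝ := ∫ t in (0 : ℝ)..φ, leafSlope n t

theorem continuous_leafSlope (n : ℕ) : Continuous (leafSlope n) :=
  (continuous_const.div (by fun_prop) fun φ => (two_add_cos_pos φ).ne').mul
    ((contDiff_leafHeight n).continuous_deriv (by simp))

theorem hasDerivAt_leafAngle (n : ℕ) (φ : ℝ) : HasDerivAt (leafAngle n) (leafSlope n φ) φ :=
  (continuous_leafSlope n).integral_hasStrictDerivAt 0 φ |>.hasDerivAt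

theorem contDiff_leafAngle (n : ℕ) : ContDiff ℝ 1 (leafAngle n) := by
  rw [contDiff_one_iff_deriv]
  refine ⟨fun φ => (hasDerivAt_leafAngle n φ).differentiableAt, ?_⟩
  rw [funext fun φ => (hasDerivAt_leafAngle n φ).deriv]
  exact continuous_leafSlope n

theorem leafAngle_add_two_pi (n : ℕ) (φ : ℝ) :
    leafAngle n (φ + 2 * Real.pi) = leafAngle n φ + leafAngle n (2 * Real.pi) := by
  have hp : Function.Periodic (leafSlope n) (2 * Real.pi) := by
    intro t
    have h1 : deriv (leafHeight n) (t + 2 * Real.pi) = deriv (leafHeight n) t := by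
      rw [← deriv_comp_add_const]
      congr 1
      exact funext (leafHeight_add_two_pi n)
    rw [leafSlope, leafSlope, h1, Real.cos_add_two_pi]
  have h2 := hp.intervalIntegral_add_eq φ 0
  have hi (a b : ℝ) : IntervalIntegrable (leafSlope n) volume a b :=
    (continuous_leafSlope n).intervalIntegrable a b
  rw [zero_add] at h2
  rw [leafAngle, ← intervalIntegral.integral_add_adjacent_intervals (hi 0 φ) (hi φ _), h2]
  rfl

/-- By parts, the integral of `2Y'/(2 + cos φ)` over a period is minus the integral of `(Y - Y(0)) ·
2 sin φ/(2 + cos φ)²`, whose integrand is nonnegative and positive at `π/2`. Geometrically, the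
factor `r²` differs between the inner and outer sides of the torus, so the turning does not cancel.
-/
theorem leafAngle_two_pi_neg {n : ℕ} (hn : n ≠ 0) : leafAngle n (2 * Real.pi) < 0 := by
  have hu (t : ℝ) : HasDerivAt (fun t => 2 / (2 + Real.cos t))
      (2 * Real.sin t / (2 + Real.cos t) ^ 2) t := by
    have h := ((Real.hasDerivAt_cos t).const_add 2).inv (two_add_cos_pos t).ne' |>.const_mul 2
    convert! h using 1
    ring
  -- Subtracting the value at `0` removes the boundary terms and gives the integrand a sign.
  have hv (t : ℝ) : HasDerivAt (fun t => leafHeight n t - leafHeight n 0)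
      (deriv (leafHeight n) t) t :=
    (((contDiff_leafHeight n).differentiable (by simp)) t).hasDerivAt.sub_const _
  have hY := (contDiff_leafHeight n).continuous
  have hc : Continuous fun t => 2 * Real.sin t / (2 + Real.cos t) ^ 2 :=
    (by fun_prop : Continuous fun t => 2 * Real.sin t).div (by fun_prop)
      fun t => (pow_pos (two_add_cos_pos t) 2).ne'
  have key := intervalIntegral.integral_mul_deriv_eq_deriv_mul (a := 0) (b := 2 * Real.pi)
    (fun t _ => hu t) (fun t _ => hv t) (hc.intervalIntegrable _ _)
    (((contDiff_leafHeight n).continuous_deriv (by simp)).intervalIntegrable _ _)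
  have h0 : leafHeight n (2 * Real.pi) = leafHeight n 0 := by
    rw [← leafHeight_add_two_pi n 0, zero_add]
  have hpos : 0 < ∫ t in (0 : ℝ)..2 * Real.pi,
      2 * Real.sin t / (2 + Real.cos t) ^ 2 * (leafHeight n t - leafHeight n 0) := by
    have hpi := Real.pi_pos
    refine intervalIntegral.integral_pos (by positivity)
      (hc.mul (hY.sub continuous_const)).continuousOn ?_ ?_
    · intro t _
      have h1 := leafHeight_sub_mul_sin_nonneg hn t
      have h2 := two_add_cos_pos t
      have : 2 * Real.sin t / (2 + Real.cos t) ^ 2 * (leafHeight n t - leafHeight n 0) =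
          2 * ((leafHeight n t - leafHeight n 0) * Real.sin t) / (2 + Real.cos t) ^ 2 := by ring
      rw [this]
      positivity
    · refine ⟨Real.pi / 2, ⟨by positivity, by linarith⟩, ?_⟩
      have := sub_pos.2 (leafHeight_zero_lt hn)
      rw [Real.sin_pi_div_two, Real.cos_pi_div_two]
      positivity
  have h1 : leafAngle n (2 * Real.pi) = ∫ t in (0 : ℝ)..2 * Real.pi,
      2 / (2 + Real.cos t) * deriv (leafHeight n) t := rfl
  rw [h1, key, h0]
  simp only [sub_self, mul_zero, zero_sub]
  linarith


/-! ### The closed horizontal leaf -/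

/-- The projection `(x, y, z) ↦ x + i y`. -/
noncomputable def planar : Heis →L[ℝ] ℂ :=
  Complex.equivRealProdCLM.symm.toContinuousLinearMap ∘L
    ((EuclideanSpace.proj 0 : Heis →L[ℝ] ℝ).prod (EuclideanSpace.proj 1))

theorem planar_re (p : Heis) : (planar p).re = p 0 := rfl

theorem planar_im (p : Heis) : (planar p).im = p 1 := rfl

/-- The horizontal leaf, on the torus of height scale `l`. -/
noncomputable def leaf (n : ℕ) (l φ : ℝ) : Heis :=
  let w : ℂ := √(2 + Real.cos φ) * Complex.exp (-(l * leafAngle n φ : ℝ) * Complex.I)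
  !₂[w.re, w.im, l * leafHeight n φ]

theorem planar_leaf (n : ℕ) (l φ : ℝ) : planar (leaf n l φ) =
    √(2 + Real.cos φ) * Complex.exp (-(l * leafAngle n φ : ℝ) * Complex.I) :=
  Complex.ext rfl rfl

theorem leaf_two (n : ℕ) (l φ : ℝ) : leaf n l φ 2 = l * leafHeight n φ := rfl

theorem ext_planar {p q : Heis} (h : planar p = planar q) (h2 : p 2 = q 2) : p = q := by
  ext i; fin_cases i
  · exact congrArg Complex.re h
  · exact congrArg Complex.im h
  · exact h2

theorem norm_exp_neg_mul_I (x : ℝ) : ‖Complex.exp (-(x : ℝ) * Complex.I)‖ = 1 := by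
  rw [← Complex.ofReal_neg, Complex.norm_exp_ofReal_mul_I]

theorem norm_planar_leaf (n : ℕ) (l φ : ℝ) : ‖planar (leaf n l φ)‖ = √(2 + Real.cos φ) := by
  rw [planar_leaf, norm_mul, norm_exp_neg_mul_I, mul_one, Complex.norm_real, Real.norm_eq_abs,
    abs_of_nonneg (Real.sqrt_nonneg _)]

theorem continuous_leaf (n : ℕ) (l : ℝ) : Continuous (leaf n l) := by
  have h1 := (contDiff_leafAngle n).continuous
  have h2 := (contDiff_leafHeight n).continuous
  have h3 : Continuous fun φ : ℝ => (√(2 + Real.cos φ) : ℂ) *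
      Complex.exp (-(l * leafAngle n φ : ℝ) * Complex.I) := by
    fun_prop
  unfold leaf
  fun_prop

theorem periodic_leaf {n : ℕ} (hn : n ≠ 0) :
    Function.Periodic (leaf n (2 * Real.pi / leafAngle n (2 * Real.pi))) (2 * Real.pi) := by
  intro φ
  have h := (leafAngle_two_pi_neg hn).ne
  refine ext_planar ?_ ?_
  · rw [planar_leaf, planar_leaf, leafAngle_add_two_pi, mul_add, div_mul_cancel₀ _ h,
      Real.cos_add_two_pi]
    congr 1
    rw [Complex.exp_eq_exp_iff_exists_int]
    -- With this `l`, a period of `φ` adds `2π` to `l` times `leafAngle`, and the exponent carries a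
    -- minus sign.
    exact ⟨-1, by push_cast; ring⟩
  · rw [leaf_two, leaf_two, leafHeight_add_two_pi]

/-- A local angular coordinate, and its derivative along curves. -/
theorem exists_angular_coordinate (q : Heis) (a : ℝ)
    (hq : planar q = ‖planar q‖ * Complex.exp (a * Complex.I)) (hq0 : planar q ≠ 0) :
    ∃ θ : Heis → ℝ, ContDiffAt ℝ 1 θ q ∧ θ q = 0 ∧ ∀ᶠ p in 𝓝 q,
      planar p = ‖planar p‖ * Complex.exp ((a + θ p : ℝ) * Complex.I) ∧
      ∀ (γ : ℝ → Heis) (t : ℝ) (v : Heis), γ t = p → HasDerivAt γ v t →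
        HasDerivAt (fun s => θ (γ s)) ((p 0 * v 1 - p 1 * v 0) / ‖planar p‖ ^ 2) t := by
  set e : ℂ := Complex.exp (-(a * Complex.I)) with he
  have hee : e * Complex.exp (a * Complex.I) = 1 := by
    rw [he, ← Complex.exp_add, neg_add_cancel, Complex.exp_zero]
  have hne : ‖e‖ = 1 := by
    rw [he, ← neg_mul, norm_exp_neg_mul_I]
  have hqe : planar q * e = ‖planar q‖ := by
    rw [hq, mul_assoc, mul_comm (Complex.exp _), hee]
    simp [Complex.norm_exp_ofReal_mul_I]
  have hslit : planar q * e ∈ Complex.slitPlane := by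
    rw [hqe]
    exact Complex.ofReal_mem_slitPlane.2 (norm_pos_iff.2 hq0)
  have hcd : ContDiff ℝ 1 fun p : Heis => planar p * e := planar.contDiff.mul contDiff_const
  refine ⟨fun p => (Complex.log (planar p * e)).im, ?_, ?_, ?_⟩
  · exact Complex.imCLM.contDiff.contDiffAt.comp q
      (((Complex.contDiffAt_log hslit).restrict_scalars ℝ).comp q hcd.contDiffAt)
  · change (Complex.log (planar q * e)).im = 0
    rw [hqe, ← Complex.ofReal_log (norm_nonneg _), Complex.ofReal_im]
  · have hev : ∀ᶠ p in 𝓝 q, planar p * e ∈ Complex.slitPlane :=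
      hcd.continuous.continuousAt.eventually (Complex.isOpen_slitPlane.mem_nhds hslit)
    refine hev.mono fun p hp => ⟨?_, ?_⟩
    · have h1 := Complex.norm_mul_exp_arg_mul_I (planar p * e)
      rw [← Complex.log_im] at h1
      rw [norm_mul, hne, mul_one] at h1
      change planar p = ‖planar p‖ *
        Complex.exp ((a + (Complex.log (planar p * e)).im : ℝ) * Complex.I)
      rw [Complex.ofReal_add, add_mul, Complex.exp_add, mul_left_comm, h1, mul_comm, mul_assoc,
        hee, mul_one]
    · rintro γ t v rfl hγ
      have h1 : HasDerivAt (fun s => planar (γ s) * e) (planar v * e) t :=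
        (planar.hasFDerivAt.comp_hasDerivAt t hγ).mul_const e
      have h2 := Complex.imCLM.hasFDerivAt.comp_hasDerivAt t (h1.clog_real hp)
      convert! h2 using 1
      have he0 : e ≠ 0 := Complex.exp_ne_zero _
      change _ = (planar v * e / (planar (γ t) * e)).im
      rw [mul_div_mul_right _ _ he0, Complex.div_im, Complex.sq_norm, planar_re, planar_re,
        planar_im, planar_im]
      ring

/-- A local coordinate along the profile of the torus. -/
theorem exists_profile_coordinate {n : ℕ} (hn : n ≠ 0) {l : ℝ} (hl : l ≠ 0) (φ₀ : ℝ) :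
    ∃ α : Heis → ℝ, ContDiffAt ℝ 1 α (leaf n l φ₀) ∧ α (leaf n l φ₀) = φ₀ ∧
      ∀ᶠ p in 𝓝 (leaf n l φ₀), cheb n (p 2 / l) ^ 2 = baseHeight (planar p) →
        p 2 = l * leafHeight n (α p) ∧ ‖planar p‖ ^ 2 = 2 + Real.cos (α p) := by
  set q := leaf n l φ₀ with hq
  have hs : √2 ^ 2 = (2 : ℝ) := Real.sq_sqrt zero_le_two
  have hs' : √2 * √(1 / 2) = (1 : ℝ) := by
    rw [← Real.sqrt_mul zero_le_two]; norm_num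
  set e : ℂ := Complex.exp (-(φ₀ * Complex.I)) with he
  have hee : e * Complex.exp (φ₀ * Complex.I) = 1 := by
    rw [he, ← Complex.exp_add, neg_add_cancel, Complex.exp_zero]
  have hne : ‖e‖ = 1 := by
    rw [he, ← neg_mul, norm_exp_neg_mul_I]
  -- On the torus `η` has modulus `1` and argument `φ`; rotating by `e` makes the principal
  -- logarithm smooth near the base point.
  let η (p : Heis) : ℂ := (‖planar p‖ ^ 2 - 2 : ℝ) + (√2 * cheb n (p 2 / l) : ℝ) * Complex.I
  have hη : ContDiff ℝ 1 η := by
    have h1 : ContDiff ℝ 1 (cheb n) := (contDiff_cheb n).of_le (by simp)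
    have h2 : ContDiff ℝ 1 fun p : Heis => ‖planar p‖ ^ 2 := planar.contDiff.norm_sq ℝ
    have h3 : ContDiff ℝ 1 fun p : Heis => p 2 / l :=
      (EuclideanSpace.proj 2 : Heis →L[ℝ] ℝ).contDiff.div_const l
    exact (Complex.ofRealCLM.contDiff.comp (h2.sub contDiff_const)).add
      ((Complex.ofRealCLM.contDiff.comp (contDiff_const.mul (h1.comp h3))).mul contDiff_const)
  have hηq : η q = Complex.exp (φ₀ * Complex.I) := by
    rw [Complex.exp_mul_I, ← Complex.ofReal_cos, ← Complex.ofReal_sin]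
    change ((‖planar q‖ ^ 2 - 2 : ℝ) : ℂ) + (√2 * cheb n (q 2 / l) : ℝ) * Complex.I = _
    rw [hq, norm_planar_leaf, Real.sq_sqrt (two_add_cos_pos _).le, leaf_two,
      mul_div_cancel_left₀ _ hl, cheb_leafHeight hn, ← mul_assoc, hs', one_mul, add_sub_cancel_left]
  have hslit : η q * e ∈ Complex.slitPlane := by
    rw [hηq, mul_comm, hee]
    exact Complex.one_mem_slitPlane
  have hcd : ContDiff ℝ 1 fun p => η p * e := hη.mul contDiff_const
  refine ⟨fun p => φ₀ + (Complex.log (η p * e)).im, ?_, ?_, ?_⟩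
  · have hlog : ContDiffAt ℝ 1 (fun p => Complex.log (η p * e)) q :=
      ContDiffAt.comp (g := Complex.log) (f := fun p => η p * e) q
        ((Complex.contDiffAt_log hslit).restrict_scalars ℝ) hcd.contDiffAt
    have him : ContDiffAt ℝ 1 (fun p => (Complex.log (η p * e)).im) q :=
      Complex.imCLM.contDiff.contDiffAt.comp q hlog
    exact contDiffAt_const.add him
  · change φ₀ + (Complex.log (η q * e)).im = φ₀
    rw [hηq, mul_comm, hee]
    simp
  · have hnode : ∀ᶠ p : Heis in 𝓝 q, node n 1 < p 2 / l := by
      have hc : Continuous fun p : Heis => p 2 / l := by fun_prop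
      refine hc.continuousAt.eventually (lt_mem_nhds ?_)
      change node n 1 < q 2 / l
      rw [hq, leaf_two, mul_div_cancel_left₀ _ hl]
      exact node_one_lt_leafHeight hn φ₀
    refine hnode.mono fun p hp hS => ?_
    have h1 : ‖η p‖ = 1 := by
      rw [← sq_eq_sq₀ (norm_nonneg _) zero_le_one, Complex.sq_norm, Complex.normSq_add_mul_I,
        mul_pow, hs, hS, baseHeight]
      ring
    have h2 : η p = Complex.exp ((φ₀ + (Complex.log (η p * e)).im : ℝ) * Complex.I) := by
      have h3 := Complex.norm_mul_exp_arg_mul_I (η p * e)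
      rw [← Complex.log_im, norm_mul, hne, mul_one, h1, Complex.ofReal_one, one_mul] at h3
      rw [Complex.ofReal_add, add_mul, Complex.exp_add, h3, mul_comm, mul_assoc, hee, mul_one]
    change p 2 = l * leafHeight n (φ₀ + (Complex.log (η p * e)).im) ∧
      ‖planar p‖ ^ 2 = 2 + Real.cos (φ₀ + (Complex.log (η p * e)).im)
    set φ := φ₀ + (Complex.log (η p * e)).im
    have hre : ‖planar p‖ ^ 2 - 2 = Real.cos φ := by
      have := congrArg Complex.re h2
      rw [Complex.exp_ofReal_mul_I_re] at this
      simpa only [η, Complex.add_re, Complex.add_im, Complex.ofReal_re, Complex.ofReal_im,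
        Complex.re_ofReal_mul, Complex.im_ofReal_mul, Complex.I_re, Complex.I_im, mul_zero, mul_one,
        add_zero, zero_add] using this
    have him : √2 * cheb n (p 2 / l) = Real.sin φ := by
      have := congrArg Complex.im h2
      rw [Complex.exp_ofReal_mul_I_im] at this
      simpa only [η, Complex.add_re, Complex.add_im, Complex.ofReal_re, Complex.ofReal_im,
        Complex.re_ofReal_mul, Complex.im_ofReal_mul, Complex.I_re, Complex.I_im, mul_zero, mul_one,
        add_zero, zero_add] using this
    refine ⟨?_, by linarith⟩
    have h4 : p 2 / l = leafHeight n φ := by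
      refine (strictMonoOn_cheb hn).injOn hp.le (node_one_lt_leafHeight hn φ).le ?_
      rw [cheb_leafHeight hn, ← him, ← mul_assoc, mul_comm √(1 / 2), hs', one_mul]
    rw [← h4, mul_div_cancel₀ _ hl]

/-! ### Horizontal curves cannot leave the leaf -/

theorem distribution_apply_two {p v : Heis} (hv : v ∈ distribution p) :
    v 2 = (p 1 * v 0 - p 0 * v 1) / 2 := by
  obtain ⟨a, b, rfl⟩ := Submodule.mem_span_pair.1 hv
  simp [F₁, F₂]
  ring

/-- Horizontal curves which start on the leaf stay on it for a short time. -/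
theorem IsAdmissible.eventually_mem_leaf {S : Set Heis} {T : ℝ} {γ : ℝ → Heis}
    (hγ : IsAdmissible S T γ) {n : ℕ} (hn : n ≠ 0) {l : ℝ} (hl : l ≠ 0) {φ₀ t₀ : ℝ}
    (hS : ∀ᶠ p in 𝓝 (leaf n l φ₀), p ∈ S → cheb n (p 2 / l) ^ 2 = baseHeight (planar p))
    (ht₀ : t₀ ∈ Ico 0 T) (h₀ : γ t₀ = leaf n l φ₀) :
    ∀ᶠ t in 𝓝[>] t₀, γ t ∈ range (leaf n l) := by
  set q := leaf n l φ₀ with hq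
  obtain ⟨α, hα, hαq, hαp⟩ := exists_profile_coordinate hn hl φ₀
  have hsq := two_add_cos_pos
  obtain ⟨θ, hθ, hθq, hθp⟩ := exists_angular_coordinate q (-(l * leafAngle n φ₀))
    (by rw [hq, norm_planar_leaf, planar_leaf, Complex.ofReal_neg])
    (by rw [← norm_pos_iff, hq, norm_planar_leaf]; exact Real.sqrt_pos.2 (hsq φ₀))
  -- This is the first integral of the characteristic foliation near `q`; its level through `q` is
  -- the leaf.
  have hf : ContDiffAt ℝ 1 (fun p => θ p + l * leafAngle n (α p)) q :=
    hθ.add (contDiffAt_const.mul ((contDiff_leafAngle n).contDiffAt.comp q hα))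
  obtain ⟨K, s, hs, hKs⟩ := hf.exists_lipschitzOnWith
  obtain ⟨K', hK'⟩ := hγ.lipschitz
  have hαd : ∀ᶠ p in 𝓝 q, DifferentiableAt ℝ α p :=
    (hα.eventually (by simp)).mono fun p hp => hp.differentiableAt one_ne_zero
  have hcont : ContinuousWithinAt γ (Icc t₀ T) t₀ :=
    (hK'.continuousOn t₀ ⟨ht₀.1, ht₀.2.le⟩).mono (Icc_subset_Icc_left ht₀.1)
  have hall : ∀ᶠ t in 𝓝[Icc t₀ T] t₀, γ t ∈ s ∧ DifferentiableAt ℝ α (γ t) ∧ _ ∧ _ ∧ _ :=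
    hcont.eventually (h₀.symm ▸ (Filter.Eventually.and hs (hαd.and (hαp.and (hθp.and hS)))))
  rw [nhdsWithin_Icc_eq_nhdsGE ht₀.2] at hall
  obtain ⟨t₁, ht₁, hU⟩ := mem_nhdsGE_iff_exists_Icc_subset.1
    (Filter.inter_mem hall (Icc_mem_nhdsGE ht₀.2))
  have ht₁ : t₀ < t₁ := ht₁
  have hsub : Icc t₀ t₁ ⊆ Icc 0 T := fun t ht =>
    ⟨ht₀.1.trans ht.1, (hU ht).2.2⟩
  have hchart (t : ℝ) (ht : t ∈ Icc t₀ t₁) : γ t 2 = l * leafHeight n (α (γ t)) ∧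
      ‖planar (γ t)‖ ^ 2 = 2 + Real.cos (α (γ t)) :=
    (hU ht).1.2.2.1 ((hU ht).1.2.2.2.2 (hγ.mapsTo (hsub ht)))
  have hlip : LipschitzOnWith (K * K') (fun t => θ (γ t) + l * leafAngle n (α (γ t)))
      (uIcc t₀ t₁) := by
    rw [uIcc_of_le ht₁.le]
    exact hKs.comp (hK'.mono hsub) fun t ht => (hU ht).1.1
  have hder : ∀ᵐ t, t ∈ uIcc t₀ t₁ →
      HasDerivAt (fun t => θ (γ t) + l * leafAngle n (α (γ t))) 0 t := by
    rw [uIcc_of_le ht₁.le]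
    have h1 := hK'.ae_differentiableWithinAt_of_mem_real
    have h2 := (ae_restrict_iff' measurableSet_Icc).1 hγ.horizontal
    filter_upwards [h1, h2, Measure.ae_ne volume t₀, Measure.ae_ne volume t₁]
      with t hd hh hne₀ hne₁ ht
    have hIoo : t ∈ Ioo t₀ t₁ := ⟨ht.1.lt_of_ne' hne₀, ht.2.lt_of_ne hne₁⟩
    have hnhds : Icc t₀ t₁ ∈ 𝓝 t := Icc_mem_nhds hIoo.1 hIoo.2
    have hγd : HasDerivAt γ (deriv γ t) t :=
      ((hd (hsub ht)).differentiableAt (mem_of_superset hnhds hsub)).hasDerivAt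
    set v := deriv γ t with hv
    have hhor := distribution_apply_two (hh (hsub ht))
    have hθd := (hU ht).1.2.2.2.1.2 γ t v rfl hγd
    obtain ⟨φ', hφ'⟩ : ∃ φ', HasDerivAt (fun s => α (γ s)) φ' t :=
      ⟨_, ((hU ht).1.2.1.hasFDerivAt.comp_hasDerivAt t hγd)⟩
    -- The vertical speed is computed from the profile and compared with its horizontal value
    -- `-(r²/2) θ'`; the two together make the derivative of the first integral vanish.
    have hz : v 2 = l * (deriv (leafHeight n) (α (γ t)) * φ') := by
      have h3 : HasDerivAt (fun s => γ s 2) (v 2) t :=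
        (EuclideanSpace.proj 2 : Heis →L[ℝ] ℝ).hasFDerivAt.comp_hasDerivAt t hγd
      have h4 : HasDerivAt (leafHeight n) (deriv (leafHeight n) (α (γ t))) (α (γ t)) :=
        ((contDiff_leafHeight n).differentiable (by simp) _).hasDerivAt
      have h6 : HasDerivAt (fun s => leafHeight n (α (γ s)))
          (deriv (leafHeight n) (α (γ t)) * φ') t :=
        HasDerivAt.comp (h₂ := leafHeight n) (h := fun s => α (γ s)) t h4 hφ'
      have h5 : HasDerivAt (fun s => l * leafHeight n (α (γ s)))
          (l * (deriv (leafHeight n) (α (γ t)) * φ')) t := h6.const_mul l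
      refine h3.unique (h5.congr_of_eventuallyEq ?_)
      filter_upwards [hnhds] with s hs using (hchart s hs).1
    have hK : HasDerivAt (fun s => l * leafAngle n (α (γ s)))
        (l * (leafSlope n (α (γ t)) * φ')) t :=
      ((hasDerivAt_leafAngle n _).comp t hφ').const_mul l
    convert! hθd.add hK using 1
    have hpos := (hsq (α (γ t))).ne'
    rw [(hchart t ht).2, leafSlope]
    field_simp
    linarith
  -- Zero derivative almost everywhere suffices only because the function is Lipschitz, hence
  -- absolutely continuous.
  obtain ⟨C, hC⟩ := hlip.absolutelyContinuousOnInterval.const_of_ae_hasDerivAt_zero hder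
  rw [uIcc_of_le ht₁.le] at hC
  have hC₀ : l * leafAngle n φ₀ = C := by
    have := hC t₀ (left_mem_Icc.2 ht₁.le)
    rwa [h₀, hθq, hαq, zero_add] at this
  filter_upwards [Icc_mem_nhdsGT ht₁] with t ht
  refine ⟨α (γ t), (ext_planar ?_ ?_).symm⟩
  · rw [planar_leaf, (hU ht).1.2.2.2.1.1]
    have h1 := hC t ht
    have h2 : ‖planar (γ t)‖ = √(2 + Real.cos (α (γ t))) := by
      rw [← (hchart t ht).2, Real.sqrt_sq (norm_nonneg _)]
    rw [h2, ← Complex.ofReal_neg]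
    congr 4
    linarith
  · exact (hchart t ht).1

/-- Horizontal curves which start on a closed leaf never leave it. -/
theorem IsAdmissible.mem_leaf {S : Set Heis} {T : ℝ} {γ : ℝ → Heis}
    (hγ : IsAdmissible S T γ) {n : ℕ} (hn : n ≠ 0) {l : ℝ} (hl : l ≠ 0)
    (hclosed : IsClosed (range (leaf n l)))
    (hS : ∀ q ∈ range (leaf n l), ∀ᶠ p in 𝓝 q,
      p ∈ S → cheb n (p 2 / l) ^ 2 = baseHeight (planar p))
    (h₀ : γ 0 ∈ range (leaf n l)) : γ T ∈ range (leaf n l) := by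
  obtain ⟨K, hK⟩ := hγ.lipschitz
  have hcl : IsClosed (γ ⁻¹' range (leaf n l) ∩ Icc 0 T) := by
    -- Continuous induction on `[0, T]`: the set of times on the leaf is closed and can always be
    -- extended to the right.
    rw [inter_comm]
    exact hK.continuousOn.preimage_isClosed_of_isClosed isClosed_Icc hclosed
  refine hcl.Icc_subset_of_forall_mem_nhdsWithin h₀ ?_ (right_mem_Icc.2 hγ.nonneg)
  rintro t ⟨⟨φ, hφ⟩, ht⟩
  exact hγ.eventually_mem_leaf hn hl (hS _ ⟨φ, rfl⟩) ht hφ.symm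


/-! ### The surfaces of infinite induced distance -/

/-- The derivative is `n U_{n-1}`. Where it vanishes, `T_n = U_n - y U_{n-1}` equals `U_n`, and
`U_n² + U_{n-1}² - 2y U_n U_{n-1} = 1` gives the value. -/
theorem cheb_sq_eq_one_of_deriv_eq_zero {n : ℕ} (hn : n ≠ 0) {y : ℝ}
    (h : deriv (cheb n) y = 0) : cheb n y ^ 2 = 1 := by
  have hU : (Polynomial.Chebyshev.U ℝ ((n : ℤ) - 1)).eval y = 0 := by
    have h1 : deriv (cheb n) y = (Polynomial.derivative (Polynomial.Chebyshev.T ℝ n)).eval y :=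
      Polynomial.deriv _
    rw [h, Polynomial.Chebyshev.T_derivative_eq_U] at h1
    simpa [hn] using h1.symm
  have hT : cheb n y = (Polynomial.Chebyshev.U ℝ n).eval y := by
    have h1 := congrArg (Polynomial.eval y) (Polynomial.Chebyshev.T_eq_U_sub_X_mul_U ℝ (n : ℤ))
    rw [Polynomial.eval_sub, Polynomial.eval_mul, hU, mul_zero, sub_zero] at h1
    exact h1
  have hS (k : ℤ) : (Polynomial.Chebyshev.S ℝ k).eval (2 * y) =
      (Polynomial.Chebyshev.U ℝ k).eval y := by
    rw [← Polynomial.Chebyshev.S_comp_two_mul_X, Polynomial.eval_comp]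
    simp
  have h2 := congrArg (Polynomial.eval (2 * y))
    (Polynomial.Chebyshev.S_sq_add_S_sq ℝ ((n : ℤ) - 1))
  simp only [Polynomial.eval_add, Polynomial.eval_sub, Polynomial.eval_mul, Polynomial.eval_pow,
    hS, hU, sub_add_cancel, ← hT, Polynomial.eval_one] at h2
  linarith

/-- The surface `cheb n (z / l)² = h (x + i y)`. -/
def chebSurface (h : ℂ → ℝ) (n : ℕ) (l : ℝ) : Set Heis :=
  {p | cheb n (p 2 / l) ^ 2 = h (planar p)}

/-- The coordinates `(x + i y, z / l)`. -/
noncomputable def heisHomeomorph {l : ℝ} (hl : l ≠ 0) : Heis ≃ₜ ℂ × ℝ where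
  toFun p := (planar p, p 2 / l)
  invFun q := !₂[q.1.re, q.1.im, l * q.2]
  left_inv p := ext_planar rfl (mul_div_cancel₀ _ hl)
  right_inv q := Prod.ext rfl (mul_div_cancel_left₀ _ hl)
  continuous_toFun := by fun_prop
  continuous_invFun := by fun_prop

theorem isClosedSurfaceOfGenus_chebSurface {c : ℂ} {ε : ℝ} (hε : 0 < ε) (hc : ‖c‖ ^ 2 = 2)
    (hε' : ε ≤ 1 / 20) {n : ℕ} (hn : 1 ≤ n) {l : ℝ} (hl : l ≠ 0) :
    IsClosedSurfaceOfGenus n (chebSurface (height c hε) n l) := by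
  obtain ⟨Θ⟩ := nonempty_homeomorph_height hε hc hε'
  exact (isClosedSurfaceOfGenus_cheb (isPillar_height hε) Θ hn).congr
    ((heisHomeomorph hl).subtype fun _ => Iff.rfl).symm

theorem abs_le_of_cheb_sq_le {n : ℕ} (hn : n ≠ 0) {y : ℝ} (h : cheb n y ^ 2 ≤ 2) : |y| ≤ 2 := by
  by_contra! hy
  have h1 : cheb n |y| ^ 2 = cheb n y ^ 2 := by
    rcases abs_choice y with h' | h' <;> rw [h']
    rw [cheb_neg, mul_pow, ← pow_mul, mul_comm n 2, pow_mul, neg_one_sq, one_pow, one_mul]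
  have h2 := le_cheb hn (by linarith : 1 ≤ |y|)
  nlinarith

theorem isCompact_chebSurface {c : ℂ} {ε : ℝ} (hε : 0 < ε) (hc : ‖c‖ ^ 2 = 2)
    (hε' : ε ≤ 1 / 20) {n : ℕ} (hn : n ≠ 0) {l : ℝ} (hl : l ≠ 0) :
    IsCompact (chebSurface (height c hε) n l) := by
  have h : IsCompact (sheeted (height c hε) (cheb n)) := by
    refine IsCompact.of_isClosed_subset
      ((isCompact_closedBall (0 : ℂ) 2).prod (isCompact_closedBall (0 : ℝ) 2))
      (isClosed_sheeted (contDiff_height hε).continuous (continuous_cheb n)) ?_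
    rintro ⟨ξ, y⟩ (hq : cheb n y ^ 2 = height c hε ξ)
    refine ⟨mem_closedBall_zero_iff.2 (norm_le_of_height_nonneg hε hc hε' ?_),
      mem_closedBall_zero_iff.2 (abs_le_of_cheb_sq_le hn ?_)⟩
    · rw [← hq]; positivity
    · rw [hq]
      exact (height_le hε ξ).trans (by nlinarith)
  exact (heisHomeomorph hl).isCompact_preimage.2 h

/-- At a singular point the planar part gives `dh = 0` and the vertical part gives `T T' = 0`; the
latter forces `h` to be `0` or `1`, which are regular values. -/
theorem isEmbeddedSurface_chebSurface {h : ℂ → ℝ} (hh : ContDiff ℝ ∞ h)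
    (hreg : ∀ ξ, h ξ = 0 ∨ h ξ = 1 → fderiv ℝ h ξ ≠ 0) {n : ℕ} (hn : n ≠ 0) {l : ℝ}
    (hl : l ≠ 0) : IsEmbeddedSurface (chebSurface h n l) := by
  intro p hp
  have hp : cheb n (p 2 / l) ^ 2 = h (planar p) := hp
  have hcoord : ContDiff ℝ ∞ fun q : Heis => q 2 / l :=
    (EuclideanSpace.proj 2 : Heis →L[ℝ] ℝ).contDiff.div_const l
  refine ⟨univ, fun q => cheb n (q 2 / l) ^ 2 - h (planar q), isOpen_univ, mem_univ _,
    (((contDiff_cheb n).comp hcoord).pow 2 |>.sub (hh.comp planar.contDiff)).contDiffOn, ?_, ?_⟩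
  · set y := p 2 / l with hy
    have h1 : HasDerivAt (fun z : ℝ => cheb n (z / l) ^ 2)
        (2 * cheb n y * (deriv (cheb n) y * (1 / l))) (p 2) := by
      have h2 : HasDerivAt (cheb n) (deriv (cheb n) y) (p 2 / l) :=
        ((contDiff_cheb n).differentiable (by simp) _).hasDerivAt
      have h3 : HasDerivAt (fun z : ℝ => cheb n (z / l)) (deriv (cheb n) y * (1 / l)) (p 2) :=
        HasDerivAt.comp (h₂ := cheb n) (h := fun z => z / l) _ h2
          ((hasDerivAt_id _).div_const l)
      have h4 := h3.pow 2
      rw [Nat.cast_ofNat, Nat.add_one_sub_one, pow_one] at h4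
      exact h4
    have h4 : HasFDerivAt (fun q : Heis => cheb n (q 2 / l) ^ 2 - h (planar q))
        ((2 * cheb n y * (deriv (cheb n) y * (1 / l))) • (EuclideanSpace.proj 2 : Heis →L[ℝ] ℝ) -
          (fderiv ℝ h (planar p)).comp planar) p := by
      have h5 : HasFDerivAt (fun q : Heis => cheb n (q 2 / l) ^ 2)
          ((2 * cheb n y * (deriv (cheb n) y * (1 / l))) •
            (EuclideanSpace.proj 2 : Heis →L[ℝ] ℝ)) p :=
        HasDerivAt.comp_hasFDerivAt (h₂ := fun z : ℝ => cheb n (z / l) ^ 2) p h1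
          (EuclideanSpace.proj 2 : Heis →L[ℝ] ℝ).hasFDerivAt
      exact h5.sub (((hh.differentiable (by simp)) _).hasFDerivAt.comp p planar.hasFDerivAt)
    rw [h4.fderiv]
    intro h0
    have hz (w : ℂ) : fderiv ℝ h (planar p) w = 0 := by
      have h5 := congrArg (fun L : Heis →L[ℝ] ℝ => L !₂[w.re, w.im, 0]) h0
      have h6 : planar !₂[w.re, w.im, 0] = w := rfl
      simpa [h6] using h5
    have hne : ¬ (h (planar p) = 0 ∨ h (planar p) = 1) := fun h' =>
      hreg _ h' (ContinuousLinearMap.ext hz)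
    have h5 := congrArg (fun L : Heis →L[ℝ] ℝ => L !₂[0, 0, 1]) h0
    have h6 : planar !₂[0, 0, 1] = 0 := rfl
    have h7 : cheb n y = 0 ∨ deriv (cheb n) y = 0 := by
      simpa [h6, hl, hz] using h5
    rcases h7 with h7 | h7
    · exact hne (Or.inl (by rw [← hp, h7]; norm_num))
    · exact hne (Or.inr (by rw [← hp, cheb_sq_eq_one_of_deriv_eq_zero hn h7]))
  · ext q
    simp [chebSurface, sub_eq_zero]

/-! ### Placing the pillar away from the leaf -/

theorem exists_norm_sq_eq_two_ne (a b : ℂ) : ∃ c : ℂ, ‖c‖ ^ 2 = 2 ∧ c ≠ a ∧ c ≠ b := by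
  have h0 : (0 : ℝ) < √2 := by positivity
  have hrank : 1 < Module.rank ℝ ℂ := by
    rw [Complex.rank_real_complex]; exact Cardinal.one_lt_two
  have hinf : (Metric.sphere (0 : ℂ) √2).Infinite := by
    refine (isPreconnected_sphere hrank 0 √2).infinite_of_nontrivial
      ⟨(√2 : ℝ), ?_, (-√2 : ℝ), ?_, ?_⟩
    · simp
    · simp
    · intro h
      have := Complex.ofReal_injective h
      linarith
  obtain ⟨c, hc, hc'⟩ := hinf.exists_notMem_finset {a, b}
  rw [mem_sphere_zero_iff_norm] at hc
  refine ⟨c, ?_, ?_⟩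
  · rw [hc, Real.sq_sqrt zero_le_two]
  · simpa using hc'

/-- A closed leaf misses some point of the central circle of the torus. -/
theorem exists_notMem_planar_leaf {n : ℕ} {l : ℝ}
    (hp : Function.Periodic (leaf n l) (2 * Real.pi)) :
    ∃ c : ℂ, ‖c‖ ^ 2 = 2 ∧ ∀ φ, planar (leaf n l φ) ≠ c := by
  obtain ⟨c, hc, h1, h2⟩ := exists_norm_sq_eq_two_ne (planar (leaf n l (Real.pi / 2)))
    (planar (leaf n l (-(Real.pi / 2))))
  refine ⟨c, hc, ?_⟩
  rintro φ rfl
  -- The leaf projects to the circle `‖ξ‖² = 2` only where `cos φ = 0`, that is, by periodicity, at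
  -- the two points avoided by `c`.
  rw [norm_planar_leaf, Real.sq_sqrt (two_add_cos_pos _).le, add_eq_left,
    Real.cos_eq_zero_iff] at hc
  obtain ⟨k, rfl⟩ := hc
  rcases Int.even_or_odd' k with ⟨m, rfl | rfl⟩
  · refine h1 (congrArg planar ?_)
    rw [← hp.int_mul m (Real.pi / 2)]
    congr 1; push_cast; ring
  · refine h2 (congrArg planar ?_)
    rw [← hp.int_mul (m + 1) (-(Real.pi / 2))]
    congr 1; push_cast; ring

theorem baseHeight_planar_leaf {n : ℕ} (hn : n ≠ 0) {l : ℝ} (hl : l ≠ 0) (φ : ℝ) :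
    cheb n (leaf n l φ 2 / l) ^ 2 = baseHeight (planar (leaf n l φ)) := by
  rw [leaf_two, mul_div_cancel_left₀ _ hl, cheb_leafHeight hn, baseHeight, norm_planar_leaf,
    Real.sq_sqrt (two_add_cos_pos _).le, mul_pow, Real.sq_sqrt (by norm_num), Real.sin_sq]
  ring

theorem inducedDist_eq_top {S : Set Heis} {q₀ q₁ : Heis}
    (h : ∀ T γ, IsAdmissible S T γ → γ 0 = q₀ → γ T ≠ q₁) : inducedDist S q₀ q₁ = ⊤ := by
  refine sInf_eq_top.2 ?_
  rintro _ ⟨T, γ, hγ, h0, h1, -⟩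
  exact absurd h1 (h T γ hγ h0)

theorem exists_infinite_inducedDist {n : ℕ} (hn : n ≠ 0) {l : ℝ} (hl : l ≠ 0)
    (hp : Function.Periodic (leaf n l) (2 * Real.pi)) :
    ∃ (c : ℂ) (ε : ℝ) (hε : 0 < ε), ‖c‖ ^ 2 = 2 ∧ ε ≤ 1 / 20 ∧
      ¬ HasFiniteInducedDist (chebSurface (height c hε) n l) := by
  obtain ⟨c, hc, hcl⟩ := exists_notMem_planar_leaf hp
  have hcomp : IsCompact (range (leaf n l)) :=
    hp.compact_of_continuous Real.two_pi_pos.ne' (continuous_leaf n l)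
  have hcl' : c ∉ planar '' range (leaf n l) := by
    rintro ⟨_, ⟨φ, rfl⟩, h⟩
    exact hcl φ h
  obtain ⟨r, hr, hball⟩ := Metric.mem_nhds_iff.1
    ((hcomp.image planar.continuous).isClosed.isOpen_compl.mem_nhds hcl')
  -- The bound `r / 4` keeps the whole disc of radius `3ε`, where `height` may differ from
  -- `baseHeight`, off the projected leaf.
  have hε : 0 < min (1 / 20) (r / 4) := by positivity
  refine ⟨c, _, hε, hc, min_le_left _ _, fun hfin => ?_⟩
  set ε := min (1 / 20) (r / 4)
  have hεr : 3 * ε < r := by linarith [min_le_right (1 / 20) (r / 4)]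
  have hfar (φ : ℝ) : 3 * ε < ‖planar (leaf n l φ) - c‖ := by
    by_contra! h
    exact hball (mem_ball_iff_norm.2 (h.trans_lt hεr)) ⟨_, ⟨φ, rfl⟩, rfl⟩
  have hnear (φ : ℝ) : ∀ᶠ p in 𝓝 (leaf n l φ), p ∈ chebSurface (height c hε) n l →
      cheb n (p 2 / l) ^ 2 = baseHeight (planar p) := by
    have : Continuous fun p : Heis => ‖planar p - c‖ := by fun_prop
    filter_upwards [this.continuousAt.eventually (lt_mem_nhds (hfar φ))] with p hp hpS
    rw [← height_of_ge hε hp.le]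
    exact hpS
  have h0 : leaf n l 0 ∈ chebSurface (height c hε) n l := by
    change cheb n (leaf n l 0 2 / l) ^ 2 = height c hε (planar (leaf n l 0))
    rw [baseHeight_planar_leaf hn hl, height_of_ge hε (hfar 0).le]
  -- The unreachable point lies over the rim of the pillar: at distance `ε` from `c` the height
  -- function is `1`, which is also the value of the polynomial at `1`.
  set q : Heis := (heisHomeomorph hl).symm (c + ε, 1)
  have hq2 : q 2 / l = 1 := mul_div_cancel_left₀ _ hl
  have hqp : planar q = c + ε := rfl
  have hnorm : ‖planar q - c‖ = ε := by
    rw [hqp, add_sub_cancel_left, Complex.norm_real, Real.norm_eq_abs, abs_of_pos hε]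
  have h1 : q ∈ chebSurface (height c hε) n l := by
    change cheb n (q 2 / l) ^ 2 = height c hε (planar q)
    rw [hq2, cheb_one, height_of_le hε (by linarith), peak, hnorm]
    ring
  refine hfin _ h0 _ h1 (inducedDist_eq_top fun T γ hγ hγ0 hγT => ?_)
  have hmem := hγ.mem_leaf hn hl hcomp.isClosed (by rintro _ ⟨φ, rfl⟩; exact hnear φ)
    (hγ0 ▸ mem_range_self 0)
  rw [hγT] at hmem
  obtain ⟨φ, hφ⟩ := hmem
  have := hfar φ
  rw [hφ, hnorm] at this
  linarith

end HeisenbergSurface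

theorem mainTheorem4 (g : ℕ) (hg : 1 ≤ g) :
    ∃ S : Set HeisenbergSurface.Heis,
      HeisenbergSurface.IsEmbeddedSurface S ∧ IsCompact S ∧
      HeisenbergSurface.IsClosedSurfaceOfGenus g S ∧
      ¬ HeisenbergSurface.HasFiniteInducedDist S := by
  open HeisenbergSurface in
  have hg0 : g ≠ 0 := Nat.one_le_iff_ne_zero.1 hg
  have hl : 2 * Real.pi / leafAngle g (2 * Real.pi) ≠ 0 :=
    div_ne_zero Real.two_pi_pos.ne' (leafAngle_two_pi_neg hg0).ne
  obtain ⟨c, ε, hε, hc, hε', h⟩ := exists_infinite_inducedDist hg0 hl (periodic_leaf hg0)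
  exact ⟨chebSurface (height c hε) g _,
    isEmbeddedSurface_chebSurface (contDiff_height hε)
      (fun ξ => fderiv_height_ne_zero hε hc hε') hg0 hl,
    isCompact_chebSurface hε hc hε' hg0 hl,
    isClosedSurfaceOfGenus_chebSurface hε hc hε' hg hl, h⟩
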